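/- Let $k>2$ be an even integer, let $\chi=\prod_v\chi_v$ be a continuous quadratic idele class character of $\mathbb{Q}$ (trivial on $\mathbb{Q}^*$, $\chi^2=1$) which is odd, i.e. $\chi_\infty=\mathrm{sgn}$, let $S'$ be the set of primes at which $\chi$ ramifies, let $p\notin S'$ be a prime, and let $f_p$ be an element of the Hecke algebra of bi-$Z_pK_p$-invariant functions on $GL_2(\mathbb{Q}_p)$ with compact support modulo the centre $Z_p$, where $K_q=GL_2(\mathbb{Z}_q)$ and $Z_q$ is the centre of $GL_2(\mathbb{Q}_q)$. For a prime $N\notin S'\cup\{p\}$ let $f=f_\infty\times\prod_q f_q$ be the following function on $GL_2(\mathbb{A})$. * $f_\infty(g)=d\,\dfrac{(2\sqrt{\det g})^k}{(a+d'+i(b-c))^k}$ for $g=\begin{pmatrix}a&b\\c&d'\end{pmatrix}$ with $\det g>0$, and $f_\infty(g)=0$ if $\det g<0$; here $d>0$ is the formal degree of the holomorphic discrete series of $PGL_2(\mathbb{R})$ of weight $k$ (any positive number, according to the Haar measure). * $f_p$ is the given function; $f_N$ is the characteristic function of $Z_NK_0(N)$ divided by the volume $V_N$ of $Z_NK_0(N)/Z_N$,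 where $K_0(N)\subset GL_2(\mathbb{Z}_N)$ is the group of matrices with lower left entry in $N\mathbb{Z}_N$ and $Z_NK_N/Z_N$ has volume $1$. * For $q\in S'$, with $q^m$ the conductor of $\chi_q$, $f_q=g(\chi_q)^{-1}\sum_{z}\chi_q(z)f_{z}$, where $z$ runs over those representatives $j/q^m$ ($0\le j<q^m$) of $q^{-m}\mathbb{Z}_q/\mathbb{Z}_q$ that have valuation $-m$, $f_z$ is the characteristic function of $\begin{pmatrix}1&z\\0&1\end{pmatrix}K_qZ_q$, and $g(\chi_q)=\int_{\mathbb{Z}_q^*}\chi_q(u)\psi_q(q^{-m}u)\,d^*u$ is the Gauss sum, with $\psi_q$ the additive character $\mathbb{Q}_q\to\mathbb{Q}_q/\mathbb{Z}_q\to\mathbb{Q}/\mathbb{Z}\to S^1$, $x\mapsto e^{2\pi i x}$, and $\mathrm{vol}(\mathbb{Z}_q^*)=1$. * For every other prime $q$, $f_q$ is the characteristic function of $Z_qK_q$. For $x\in\mathbb{Q}^*-\{1\}$ put $\xi(x)=\begin{pmatrix}1&x\\1&1\end{pmatrix}$ and $t_a=\begin{pmatrix}a&0\\0&1\end{pmatrix}$,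 and for $c>0$ and $s_1,s_2\in\mathbb{C}$ put $$I_c(x,f;s_1,s_2)=\iint_{a,b\in\mathbb{A}^*,\ c^{-1}<|a|,|b|<c} f(t_a^{-1}\xi(x)t_b)\,\chi(a)|a|^{s_1}|b|^{s_2}\,d^*a\,d^*b ,$$ with the Haar measure on $\mathbb{A}^*$ that is the product of $dx/|x|$ on $\mathbb{R}^*$ and of the Haar measures on the $\mathbb{Q}_q^*$ giving $\mathbb{Z}_q^*$ volume $1$. The regular orbital term is $$I(x,f)=\lim_{s_1,s_2\to0}\ \lim_{c\to\infty}I_c(x,f;s_1,s_2).$$ **Proposition 3.1.** Let $\varepsilon>0$. There is a constant $C>0$, depending only on $\varepsilon,k,d,\chi,p,f_p$, such that for every prime $N\notin S'\cup\{p\}$: for every $x\in\mathbb{Q}^*-\{1\}$ the integrals $I_c(x,f;s_1,s_2)$ converge absolutely for $(s_1,s_2)\neq(0,0)$ near $(0,0)$ and the limits defining $I(x,f)$ exist, the series $$I_{\mathrm{reg}}(f):=\sum_{x\in\mathbb{Q}^*-\{1\}}I(x,f)$$ converges absolutely, and $$|I_{\mathrm{reg}}(f)|\le\frac{C}{N^{k/2-\varepsilon}}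 .$$ -/

import Mathlib

open Filter Topology MeasureTheory Matrix
open scoped RestrictedProduct

instance instFactPrimeOfPrimes (q : Nat.Primes) : Fact (q : ℕ).Prime := ⟨q.2⟩

noncomputable section

namespace RelTrace

/-! ### Ideles of `ℚ` -/

/-- The units `ℤ_q^*`, as a subgroup of `ℚ_q^*`. -/
def padicUnits (q : Nat.Primes) : Subgroup ℚ_[q]ˣ where
  carrier := {u | ‖(u : ℚ_[q])‖ = 1}
  one_mem' := by simp
  mul_mem' := by
    intro a b ha hb
    simp only [Set.mem_ofPred_eq] at ha hb ⊢
    simp [ha, hb]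
  inv_mem' := by
    intro a ha
    simp only [Set.mem_ofPred_eq] at ha ⊢
    simp [ha]

theorem isOpen_padicUnits (q : Nat.Primes) : IsOpen (padicUnits q : Set ℚ_[q]ˣ) := by
  have h : IsOpen (Metric.sphere (0 : ℚ_[q]) 1) := IsUltrametricDist.isOpen_sphere 0 one_ne_zero
  have h2 : (padicUnits q : Set ℚ_[q]ˣ) = Units.val ⁻¹' (Metric.sphere (0 : ℚ_[q]) 1) := by
    ext u
    simp [padicUnits]
  rw [h2]
  exact h.preimage Units.continuous_val

theorem isCompact_padicUnits (q : Nat.Primes) : IsCompact (padicUnits q : Set ℚ_[q]ˣ) := by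
  have h2 : (padicUnits q : Set ℚ_[q]ˣ) =
      Set.range (Units.map (PadicInt.Coe.ringHom (p := q)).toMonoidHom) := by
    ext u
    simp only [Set.mem_range]
    constructor
    · intro hu
      have hu1 : ‖(u : ℚ_[q])‖ = 1 := hu
      refine ⟨⟨⟨u, hu1.le⟩, ⟨(u : ℚ_[q])⁻¹, by simp [hu1]⟩, ?_, ?_⟩, ?_⟩
      · exact Subtype.ext (mul_inv_cancel₀ u.ne_zero)
      · exact Subtype.ext (inv_mul_cancel₀ u.ne_zero)
      · ext; rfl
    · rintro ⟨v, rfl⟩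
      exact PadicInt.isUnit_iff.mp v.isUnit
  rw [h2]
  refine isCompact_range ?_
  exact Continuous.units_map _ continuous_subtype_val

instance instFactIsOpenPadicUnits :
    Fact (∀ q : Nat.Primes, IsOpen (padicUnits q : Set ℚ_[q]ˣ)) := ⟨isOpen_padicUnits⟩

instance instCompactSpacePadicUnits (q : Nat.Primes) : CompactSpace (padicUnits q) :=
  isCompact_iff_compactSpace.mp (isCompact_padicUnits q)

/-- The finite ideles of `ℚ`: the restricted product of the `ℚ_q^*` with respect to the `ℤ_q^*`,
with its usual topology. -/
abbrev FiniteIdeles : Type := Πʳ q : Nat.Primes, [ℚ_[q]ˣ, padicUnits q]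

instance instMeasurableSpaceFiniteIdeles : MeasurableSpace FiniteIdeles := borel _

instance instBorelSpaceFiniteIdeles : BorelSpace FiniteIdeles := ⟨rfl⟩

/-- The idele group `𝔸^*` of `ℚ`. -/
abbrev Ideles : Type := ℝˣ × FiniteIdeles

/-- The compact open subgroup `∏_q ℤ_q^*` of the finite ideles. -/
def integralIdeles : TopologicalSpace.PositiveCompacts FiniteIdeles where
  carrier := Set.range (RestrictedProduct.structureMap (fun q : Nat.Primes => ℚ_[q]ˣ)
    (fun q => (padicUnits q : Set ℚ_[q]ˣ)) cofinite)
  isCompact' := by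
    have (q : Nat.Primes) : CompactSpace ↥(padicUnits q : Set ℚ_[q]ˣ) :=
      isCompact_iff_compactSpace.mp (isCompact_padicUnits q)
    exact isCompact_range RestrictedProduct.isEmbedding_structureMap.continuous
  interior_nonempty' := by
    rw [(RestrictedProduct.isOpenEmbedding_structureMap isOpen_padicUnits).isOpen_range.interior_eq]
    exact ⟨_, ⟨fun q => ⟨1, (padicUnits q).one_mem⟩, rfl⟩⟩

/-- The measure `dx / |x|` on `ℝ^*`. -/
def realUnitsMeasure : Measure ℝˣ :=
  Measure.comap Units.val ((volume : Measure ℝ).withDensity fun x => ENNReal.ofReal |x|⁻¹)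

/-- The Haar measure `d^*a` on the ideles: the product of `dx / |x|` on `ℝ^*` and of the Haar
measure of the finite ideles that gives `∏_q ℤ_q^*` volume `1` (so each `ℤ_q^*` has volume `1`). -/
def ideleMeasure : Measure Ideles :=
  realUnitsMeasure.prod (Measure.haarMeasure integralIdeles)

/-- The idele norm `|a| = ∏_v |a_v|_v`. -/
def ideleNorm (a : Ideles) : ℝ := |(a.1 : ℝ)| * ∏ᶠ q : Nat.Primes, ‖(a.2 q : ℚ_[q])‖

theorem eventually_norm_rat_le_one (x : ℚ) :
    ∀ᶠ q : Nat.Primes in cofinite, ‖(x : ℚ_[q])‖ ≤ 1 := by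
  have hfin : {q : Nat.Primes | (q : ℕ) ∣ x.den}.Finite := by
    refine Set.Finite.of_finite_image (f := fun q : Nat.Primes => (q : ℕ))
      ((Finset.range (x.den + 1)).finite_toSet.subset ?_) Subtype.val_injective.injOn
    rintro _ ⟨q, hq, rfl⟩
    have := Nat.le_of_dvd x.den_pos hq
    simp
    omega
  filter_upwards [hfin.compl_mem_cofinite] with q hq
  exact Padic.norm_rat_le_one hq

/-- The diagonal embedding of `ℚ^*` into the ideles. -/
def rationalIdele (x : ℚˣ) : Ideles :=
  (Units.map (Rat.castHom ℝ).toMonoidHom x,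
    RestrictedProduct.mk (fun q : Nat.Primes => Units.map (Rat.castHom ℚ_[q]).toMonoidHom x) (by
      filter_upwards [eventually_norm_rat_le_one (x : ℚ),
        eventually_norm_rat_le_one ((x⁻¹ : ℚˣ) : ℚ)] with q h1 h2
      change ‖((x : ℚ) : ℚ_[q])‖ = 1
      have h3 : ((x : ℚ) : ℚ_[q]) ≠ 0 := by simp
      have h4 : 0 < ‖((x : ℚ) : ℚ_[q])‖ := norm_pos_iff.mpr h3
      have h5 : ‖((x : ℚ) : ℚ_[q])‖⁻¹ ≤ 1 := by simpa using h2
      exact le_antisymm h1 ((inv_le_one₀ h4).mp h5)))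

/-! ### Local components of an idele character -/

/-- The component at `q` of a character of the ideles. -/
def localChar (χ : Ideles →* ℂˣ) (q : Nat.Primes) (u : ℚ_[q]ˣ) : ℂˣ :=
  χ (1, RestrictedProduct.mulSingle padicUnits q u)

/-- The component at the real place of a character of the ideles. -/
def realChar (χ : Ideles →* ℂˣ) (u : ℝˣ) : ℂˣ := χ (u, 1)

/-- The exponent `m` of the conductor `q^m` of `χ_q`: the least `m` such that `χ_q` is trivial on
the units congruent to `1` modulo `q^m` (on all units, for `m = 0`). -/
def conductorExponent (χ : Ideles →* ℂˣ) (q : Nat.Primes) : ℕ :=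
  sInf {m : ℕ | ∀ u ∈ padicUnits q,
    ‖(u : ℚ_[q]) - 1‖ ≤ (q : ℝ) ^ (-(m : ℤ)) → localChar χ q u = 1}

/-- `χ` is ramified at `q`. -/
def IsRamifiedAt (χ : Ideles →* ℂˣ) (q : Nat.Primes) : Prop :=
  ¬ ∀ u ∈ padicUnits q, localChar χ q u = 1

/-- The Gauss sum `g(χ_q) = ∫_{ℤ_q^*} χ_q(u) ψ_q(q^{-m} u) d^*u`, with `q^m` the conductor of `χ_q`,
`ψ_q` the additive character `ℚ_q → ℚ_q/ℤ_q → ℚ/ℤ → S^1`, `x ↦ e^{2πix}`, and `ℤ_q^*` of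
volume `1`. The class of `q^{-m} u` in `ℚ/ℤ` is that of `j / q^m` for any integer
`j ≡ u (mod q^m)`. -/
def gaussSum (χ : Ideles →* ℂˣ) (q : Nat.Primes) : ℂ :=
  letI : MeasurableSpace ℤ_[q]ˣ := borel _
  haveI : BorelSpace ℤ_[q]ˣ := ⟨rfl⟩
  ∫ u : ℤ_[q]ˣ,
    (localChar χ q (Units.map (PadicInt.Coe.ringHom (p := q)).toMonoidHom u) : ℂ) *
      Complex.exp (2 * Real.pi * Complex.I *
        (((PadicInt.toZModPow (conductorExponent χ q) (u : ℤ_[q])).val : ℂ) /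
          (q : ℂ) ^ conductorExponent χ q))
    ∂(Measure.haarMeasure ⊤)

/-! ### Subgroups of `GL₂(ℚ_q)` -/

/-- `K_q = GL₂(ℤ_q)`, as a subgroup of `GL₂(ℚ_q)`. -/
def maximalCompact (q : Nat.Primes) : Subgroup (GL (Fin 2) ℚ_[q]) :=
  (GeneralLinearGroup.map (n := Fin 2) (PadicInt.Coe.ringHom (p := q))).range

/-- The subgroup of `GL₂(ℤ_q)` of matrices with lower left entry divisible by `q`. -/
def integralIwahori (q : Nat.Primes) : Subgroup (GL (Fin 2) ℤ_[q]) where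
  carrier := {g | (q : ℤ_[q]) ∣ g 1 0}
  one_mem' := by simp
  mul_mem' := by
    intro a b ha hb
    simp only [Set.mem_ofPred_eq, Units.val_mul, Matrix.mul_apply, Fin.sum_univ_two] at ha hb ⊢
    exact dvd_add (ha.mul_right _) (hb.mul_left _)
  inv_mem' := by
    intro a ha
    simp only [Set.mem_ofPred_eq] at ha ⊢
    rw [Matrix.coe_units_inv, Matrix.inv_def, Matrix.adjugate_fin_two]
    simpa using ha.mul_left (Ring.inverse (a : Matrix (Fin 2) (Fin 2) ℤ_[q]).det)

/-- `K_0(q)`, as a subgroup of `GL₂(ℚ_q)`. -/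
def iwahori (q : Nat.Primes) : Subgroup (GL (Fin 2) ℚ_[q]) :=
  (integralIwahori q).map (GeneralLinearGroup.map (n := Fin 2) (PadicInt.Coe.ringHom (p := q)))

/-- `Z_q K_q`, with `Z_q` the centre of `GL₂(ℚ_q)`. -/
def centerMaximal (q : Nat.Primes) : Subgroup (GL (Fin 2) ℚ_[q]) :=
  Subgroup.center _ ⊔ maximalCompact q

/-- `Z_q K_0(q)`. -/
def centerIwahori (q : Nat.Primes) : Subgroup (GL (Fin 2) ℚ_[q]) :=
  Subgroup.center _ ⊔ iwahori q

/-- The volume of `Z_q K_0(q) / Z_q` for the Haar measure of `GL₂(ℚ_q) / Z_q` that gives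
`Z_q K_q / Z_q` volume `1`: the reciprocal of the (finite) index of the open subgroup
`Z_q K_0(q)` in `Z_q K_q`. -/
def iwahoriVolume (q : Nat.Primes) : ℝ :=
  ((centerIwahori q).relIndex (centerMaximal q) : ℝ)⁻¹

/-- The Hecke algebra of bi-`Z_p K_p`-invariant functions on `GL₂(ℚ_p)` with compact support
modulo `Z_p`: the span of the characteristic functions of the double cosets of `Z_p K_p`. -/
def heckeAlgebra (p : Nat.Primes) : Submodule ℂ (GL (Fin 2) ℚ_[p] → ℂ) :=
  Submodule.span ℂ (Set.range fun g : GL (Fin 2) ℚ_[p] =>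
    Set.indicator (DoubleCoset.doubleCoset g (centerMaximal p) (centerMaximal p)) fun _ => (1 : ℂ))

/-! ### Matrices -/

/-- `t_a = (a 0; 0 1)`. -/
def torus {F : Type*} [Field F] (a : Fˣ) : GL (Fin 2) F :=
  GeneralLinearGroup.mkOfDetNeZero !![(a : F), 0; 0, 1] (by simp)

/-- The unipotent matrix `(1 z; 0 1)`. -/
def unipotent {F : Type*} [Field F] (z : F) : GL (Fin 2) F :=
  GeneralLinearGroup.mkOfDetNeZero !![1, z; 0, 1] (by simp)

/-- The parameters `x ∈ ℚ^* - {1}` of the regular double cosets of the torus. -/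
abbrev RegularParam : Type := {x : ℚ // x ≠ 0 ∧ x ≠ 1}

/-- `ξ(x) = (1 x; 1 1)`, the representative of a regular double coset. -/
def xi (x : RegularParam) : GL (Fin 2) ℚ :=
  GeneralLinearGroup.mkOfDetNeZero !![1, (x : ℚ); 1, 1] (by
    have h := x.2.2
    simp only [Matrix.det_fin_two_of, mul_one]
    exact sub_ne_zero.mpr (Ne.symm h))

/-! ### The test function -/

/-- The archimedean test function of weight `k`: `d` times the complex conjugate of the normalized
lowest weight matrix coefficient of the holomorphic discrete series of weight `k`, where `d` is the
formal degree. -/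
def archTest (k : ℕ) (d : ℝ) (g : GL (Fin 2) ℝ) : ℂ :=
  if 0 < (g : Matrix (Fin 2) (Fin 2) ℝ).det then
    (d : ℂ) * ((2 * Real.sqrt (g : Matrix (Fin 2) (Fin 2) ℝ).det : ℝ) : ℂ) ^ k /
      (((g 0 0 + g 1 1 : ℝ) : ℂ) + Complex.I * ((g 0 1 - g 1 0 : ℝ) : ℂ)) ^ k
  else 0

/-- The characteristic function of `Z_q K_q`. -/
def unramifiedTest (q : Nat.Primes) : GL (Fin 2) ℚ_[q] → ℂ :=
  Set.indicator (centerMaximal q : Set (GL (Fin 2) ℚ_[q])) fun _ => 1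

/-- The characteristic function of `Z_q K_0(q)`, divided by the volume of `Z_q K_0(q) / Z_q`. -/
def levelTest (q : Nat.Primes) : GL (Fin 2) ℚ_[q] → ℂ :=
  Set.indicator (centerIwahori q : Set (GL (Fin 2) ℚ_[q])) fun _ => ((iwahoriVolume q)⁻¹ : ℝ)

/-- `χ_q` as a character of `q^{-m} ℤ_q / ℤ_q ≅ ℤ / q^m` extended by `0` to the non-units, with `q^m`
the conductor of `χ_q`: it sends `z` to `χ_q(z)` if `z` has valuation exactly `-m`, and to `0`
otherwise. -/
def twistWeight (χ : Ideles →* ℂˣ) (q : Nat.Primes) (z : ℚ_[q]) : ℂ :=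
  if h : ‖z‖ = (q : ℝ) ^ conductorExponent χ q then
    (localChar χ q (Units.mk0 z (by
      intro hz
      rw [hz, norm_zero] at h
      exact (pow_pos (Nat.cast_pos.mpr q.2.pos) _).ne h)) : ℂ)
  else 0

/-- The test function at a prime `q` where `χ` is ramified: `g(χ_q)⁻¹ ∑_z χ_q(z) f_z`, where `z` runs
over the representatives `j / q^m`, `0 ≤ j < q^m`, of `q^{-m} ℤ_q / ℤ_q`, and `f_z` is the
characteristic function of `(1 z; 0 1) K_q Z_q`. -/
def ramifiedTest (χ : Ideles →* ℂˣ) (q : Nat.Primes) (g : GL (Fin 2) ℚ_[q]) : ℂ :=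
  (gaussSum χ q)⁻¹ * ∑ j ∈ Finset.range ((q : ℕ) ^ conductorExponent χ q),
    twistWeight χ q ((j : ℚ_[q]) / (q : ℚ_[q]) ^ conductorExponent χ q) *
      unramifiedTest q ((unipotent ((j : ℚ_[q]) / (q : ℚ_[q]) ^ conductorExponent χ q))⁻¹ * g)

open Classical in
/-- The local test functions at the finite primes: `fp` at `p`, the level structure at `N`, the
twisted functions at the ramified primes of `χ`, and the characteristic function of `Z_q K_q` at all
other primes `q`. -/
def localTest (χ : Ideles →* ℂˣ) (p : Nat.Primes) (fp : GL (Fin 2) ℚ_[p] → ℂ) (N : Nat.Primes) :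
    ∀ q : Nat.Primes, GL (Fin 2) ℚ_[q] → ℂ :=
  Function.update (fun q => if q = N then levelTest q
    else if IsRamifiedAt χ q then ramifiedTest χ q else unramifiedTest q) p fp

/-- The factorizable test function `f = f_∞ × ∏_q f_q`, at the element of `GL₂(𝔸)` with components
`gInf` and `g q`. On `GL₂(𝔸)` all but finitely many of the factors are `0` or `1`, and the product is
finite. -/
def testFunction (k : ℕ) (d : ℝ) (χ : Ideles →* ℂˣ) (p : Nat.Primes)
    (fp : GL (Fin 2) ℚ_[p] → ℂ) (N : Nat.Primes) (gInf : GL (Fin 2) ℝ)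
    (g : ∀ q : Nat.Primes, GL (Fin 2) ℚ_[q]) : ℂ :=
  archTest k d gInf * ∏ᶠ q : Nat.Primes, localTest χ p fp N q (g q)

/-! ### Regular orbital integrals -/

/-- The integrand `f(t_a⁻¹ ξ(x) t_b) χ(a) |a|^{s₁} |b|^{s₂}`. -/
def orbitalIntegrand (k : ℕ) (d : ℝ) (χ : Ideles →* ℂˣ) (p : Nat.Primes)
    (fp : GL (Fin 2) ℚ_[p] → ℂ) (N : Nat.Primes) (x : RegularParam) (s : ℂ × ℂ)
    (ab : Ideles × Ideles) : ℂ :=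
  testFunction k d χ p fp N
      ((torus ab.1.1)⁻¹ * GeneralLinearGroup.map (Rat.castHom ℝ) (xi x) * torus ab.2.1)
      (fun q => (torus (ab.1.2 q))⁻¹ * GeneralLinearGroup.map (Rat.castHom ℚ_[q]) (xi x) *
        torus (ab.2.2 q)) *
    (χ ab.1 : ℂ) * (ideleNorm ab.1 : ℂ) ^ s.1 * (ideleNorm ab.2 : ℂ) ^ s.2

/-- The region `c⁻¹ < |a|, |b| < c` of `𝔸^* × 𝔸^*`. -/
def truncation (c : ℝ) : Set (Ideles × Ideles) :=
  {ab | c⁻¹ < ideleNorm ab.1 ∧ ideleNorm ab.1 < c ∧ c⁻¹ < ideleNorm ab.2 ∧ ideleNorm ab.2 < c}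

/-- The truncated orbital integral `I_c(ξ(x), f; s₁, s₂)`. The stabilizer of a regular element is
trivial, so the integral is over all of `𝔸^* × 𝔸^*`. -/
def truncatedIntegral (k : ℕ) (d : ℝ) (χ : Ideles →* ℂˣ) (p : Nat.Primes)
    (fp : GL (Fin 2) ℚ_[p] → ℂ) (N : Nat.Primes) (x : RegularParam) (c : ℝ) (s : ℂ × ℂ) : ℂ :=
  ∫ ab in truncation c, orbitalIntegrand k d χ p fp N x s ab ∂(ideleMeasure.prod ideleMeasure)

/-- `L` is the regular orbital term `I(x, f) = lim_{s₁, s₂ → 0} lim_{c → ∞} I_c(ξ(x), f; s₁, s₂)`: for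
all `(s₁, s₂) ≠ 0` near `0` the truncated integrals converge absolutely and tend to a limit
`J (s₁, s₂)` as `c → ∞`, and `J (s₁, s₂) → L` as `(s₁, s₂) → 0`. -/
def IsRegularTerm (k : ℕ) (d : ℝ) (χ : Ideles →* ℂˣ) (p : Nat.Primes)
    (fp : GL (Fin 2) ℚ_[p] → ℂ) (N : Nat.Primes) (x : RegularParam) (L : ℂ) : Prop :=
  ∃ J : ℂ × ℂ → ℂ,
    (∀ᶠ s in 𝓝[≠] (0 : ℂ × ℂ),
      (∀ c : ℝ, IntegrableOn (orbitalIntegrand k d χ p fp N x s) (truncation c)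
        (ideleMeasure.prod ideleMeasure)) ∧
      Tendsto (fun c : ℝ => truncatedIntegral k d χ p fp N x c s) atTop (𝓝 (J s))) ∧
    Tendsto J (𝓝[≠] (0 : ℂ × ℂ)) (𝓝 L)

end RelTrace

end

/-! For every large level each regular term is zero, so no power of `N` has to be won by estimates.
At `s = 0` the orbital integral converges absolutely and splits into a real integral times a
finite-adelic one (`integral_orbitalIntegrand_zero`).

If `x > 0`, the real factor vanishes (`integral_archOrbit_eq_zero`): a measure-preserving involution
of the pairs `(a, b)` reverses the sign of `a` wherever the test function is nonzero, keeps that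
function unchanged, and hence negates the integrand, because `χ` is odd.

If `x < 0`, the finite factor is controlled by integrality (`exists_bound_of_finiteOrbit_ne_zero`).
The local supports are bounded modulo the centre, uniformly in `N`, which forces `w = D / (1 - x)`
to be an integer for a fixed denominator `D`. Negativity of `x` gives `0 < w < D`, so only finitely
many `x` survive, independently of `N`. The level structure at `N` requires in addition `|x| < |1 -
x|` in `ℚ_N`, so `N` divides `D - w = -D x / (1 - x)`, a positive integer below `D`. Hence `N < D`.

Thus the sum over `x` is always finite and vanishes for `N > D`, and the finitely many remaining
primes are absorbed into `C`. The analytic work lies in the existence of the limits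
(`isRegularTerm_integral`): one integrable majorant, valid for all `s` near `0`, handles both `c →
∞` and `s → 0`. -/

noncomputable section

namespace RelTrace

/-! ### Matrices over `ℚ_q` bounded modulo the centre -/

section Local

variable {q : Nat.Primes}

/-- Products of two entries of `g` are bounded by `M * |det g|`; this is a bound for `g` modulo the
centre of `GL₂(ℚ_q)`. -/
def BoundedModCenter (M : ℝ) (g : GL (Fin 2) ℚ_[q]) : Prop :=
  ∀ i j k l, ‖g i j‖ * ‖g k l‖ ≤ M * ‖(g : Matrix (Fin 2) (Fin 2) ℚ_[q]).det‖

theorem norm_det_pos (g : GL (Fin 2) ℚ_[q]) :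
    0 < ‖(g : Matrix (Fin 2) (Fin 2) ℚ_[q]).det‖ :=
  norm_pos_iff.mpr (by
    have := (Matrix.isUnit_iff_isUnit_det (g : Matrix (Fin 2) (Fin 2) ℚ_[q])).mp g.isUnit
    exact this.ne_zero)

theorem BoundedModCenter.mono {M M' : ℝ} (h : M ≤ M') {g : GL (Fin 2) ℚ_[q]}
    (hg : BoundedModCenter M g) : BoundedModCenter M' g := fun i j k l =>
  (hg i j k l).trans (mul_le_mul_of_nonneg_right h (norm_nonneg _))

theorem exists_boundedModCenter (g : GL (Fin 2) ℚ_[q]) : ∃ M, BoundedModCenter M g := by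
  have h (i j k l : Fin 2) : ∃ M, ‖g i j‖ * ‖g k l‖ ≤
      M * ‖(g : Matrix (Fin 2) (Fin 2) ℚ_[q]).det‖ :=
    ⟨_, (div_mul_cancel₀ _ (norm_det_pos g).ne').ge⟩
  choose M hM using h
  refine ⟨∑ i, ∑ j, ∑ k, ∑ l, |M i j k l|, fun i j k l => (hM i j k l).trans
    (mul_le_mul_of_nonneg_right ?_ (norm_nonneg _))⟩
  refine (le_abs_self _).trans ?_
  refine le_trans ?_ (Finset.single_le_sum (f := fun i => ∑ j, ∑ k, ∑ l, |M i j k l|)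
    (fun _ _ => by positivity) (Finset.mem_univ i))
  refine le_trans ?_ (Finset.single_le_sum (f := fun j => ∑ k, ∑ l, |M i j k l|)
    (fun _ _ => by positivity) (Finset.mem_univ j))
  refine le_trans ?_ (Finset.single_le_sum (f := fun k => ∑ l, |M i j k l|)
    (fun _ _ => by positivity) (Finset.mem_univ k))
  exact Finset.single_le_sum (f := fun l => |M i j k l|) (fun _ _ => by positivity)
    (Finset.mem_univ l)

/-- By the ultrametric inequality a single summand dominates, so bounds modulo the centre multiply
with no factor `2`. This keeps the bound exactly `1` on `Z_q K_q`, as integrality of `D / (1 - x)`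
at almost all primes requires. -/
theorem exists_norm_mul_apply_le (g h : GL (Fin 2) ℚ_[q]) (i j : Fin 2) :
    ∃ s, ‖(g * h) i j‖ ≤ ‖g i s‖ * ‖h s j‖ := by
  have h1 : (g * h) i j = g i 0 * h 0 j + g i 1 * h 1 j := by
    simp [Matrix.mul_apply, Fin.sum_univ_two]
  have h2 := IsUltrametricDist.norm_add_le_max (g i 0 * h 0 j) (g i 1 * h 1 j)
  rw [← h1, norm_mul, norm_mul] at h2
  rcases le_max_iff.mp h2 with h3 | h3
  exacts [⟨0, h3⟩, ⟨1, h3⟩]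

theorem BoundedModCenter.mul {M M' : ℝ} {g h : GL (Fin 2) ℚ_[q]}
    (hg : BoundedModCenter M g) (hh : BoundedModCenter M' h) : BoundedModCenter (M * M') (g * h) := by
  intro i j k l
  obtain ⟨s, hs⟩ := exists_norm_mul_apply_le g h i j
  obtain ⟨t, ht⟩ := exists_norm_mul_apply_le g h k l
  calc ‖(g * h) i j‖ * ‖(g * h) k l‖ ≤ (‖g i s‖ * ‖h s j‖) * (‖g k t‖ * ‖h t l‖) := by gcongr
    _ = (‖g i s‖ * ‖g k t‖) * (‖h s j‖ * ‖h t l‖) := by ring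
    _ ≤ (M * ‖(g : Matrix (Fin 2) (Fin 2) ℚ_[q]).det‖) *
        (M' * ‖(h : Matrix (Fin 2) (Fin 2) ℚ_[q]).det‖) :=
      mul_le_mul (hg _ _ _ _) (hh _ _ _ _) (by positivity)
        (le_trans (by positivity) (hg 0 0 0 0))
    _ = _ := by simp only [Units.val_mul, Matrix.det_mul, norm_mul]; ring

theorem mem_center_apply {z : GL (Fin 2) ℚ_[q]} (hz : z ∈ Subgroup.center (GL (Fin 2) ℚ_[q])) :
    ∃ r : ℚ_[q], (z : Matrix (Fin 2) (Fin 2) ℚ_[q]) = !![r, 0; 0, r] := by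
  obtain ⟨r, hr⟩ := GeneralLinearGroup.mem_center_iff_val_mem_range_scalar.mp hz
  refine ⟨r, hr.symm.trans ?_⟩
  ext i j
  fin_cases i <;> fin_cases j <;> simp

theorem boundedModCenter_of_mem_center {z : GL (Fin 2) ℚ_[q]}
    (hz : z ∈ Subgroup.center (GL (Fin 2) ℚ_[q])) : BoundedModCenter 1 z := by
  obtain ⟨r, hr⟩ := mem_center_apply hz
  intro i j k l
  rw [hr]
  fin_cases i <;> fin_cases j <;> fin_cases k <;> fin_cases l <;>
    simp [mul_self_nonneg]

theorem integral_of_mem_maximalCompact {g : GL (Fin 2) ℚ_[q]} (hg : g ∈ maximalCompact q) :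
    (∀ i j, ‖g i j‖ ≤ 1) ∧ ‖(g : Matrix (Fin 2) (Fin 2) ℚ_[q]).det‖ = 1 := by
  obtain ⟨h, rfl⟩ := hg
  refine ⟨fun i j => PadicInt.norm_le_one _, ?_⟩
  have h1 := (Matrix.isUnit_iff_isUnit_det (h : Matrix (Fin 2) (Fin 2) ℤ_[q])).mp h.isUnit
  have h2 : ((GeneralLinearGroup.map (n := Fin 2) (PadicInt.Coe.ringHom (p := q)) h :
      GL (Fin 2) ℚ_[q]) : Matrix (Fin 2) (Fin 2) ℚ_[q]).det =
      ((h : Matrix (Fin 2) (Fin 2) ℤ_[q]).det : ℚ_[q]) := by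
    simp [Matrix.det_fin_two]
    rfl
  rw [h2]
  exact PadicInt.isUnit_iff.mp h1

theorem exists_integral_lift {g : GL (Fin 2) ℚ_[q]} (h : ∀ i j, ‖g i j‖ ≤ 1)
    (hdet : ‖(g : Matrix (Fin 2) (Fin 2) ℚ_[q]).det‖ = 1) :
    ∃ h : GL (Fin 2) ℤ_[q], GeneralLinearGroup.map (n := Fin 2) (PadicInt.Coe.ringHom (p := q)) h = g := by
  let A : Matrix (Fin 2) (Fin 2) ℤ_[q] := Matrix.of fun i j => ⟨g i j, h i j⟩
  have hA : (A.det : ℚ_[q]) = (g : Matrix (Fin 2) (Fin 2) ℚ_[q]).det := by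
    rw [Matrix.det_fin_two, Matrix.det_fin_two]
    rfl
  have hu : IsUnit A := (Matrix.isUnit_iff_isUnit_det A).mpr (PadicInt.isUnit_iff.mpr (by
    rw [← hdet, ← hA]; rfl))
  refine ⟨hu.unit, ?_⟩
  ext i j
  rfl

theorem mem_maximalCompact_of_integral {g : GL (Fin 2) ℚ_[q]} (h : ∀ i j, ‖g i j‖ ≤ 1)
    (hdet : ‖(g : Matrix (Fin 2) (Fin 2) ℚ_[q]).det‖ = 1) : g ∈ maximalCompact q :=
  exists_integral_lift h hdet

theorem mem_iwahori_of_integral {g : GL (Fin 2) ℚ_[q]} (h : ∀ i j, ‖g i j‖ ≤ 1)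
    (hdet : ‖(g : Matrix (Fin 2) (Fin 2) ℚ_[q]).det‖ = 1) (h10 : ‖g 1 0‖ < 1) :
    g ∈ iwahori q := by
  obtain ⟨u, rfl⟩ := exists_integral_lift h hdet
  refine ⟨u, ?_, rfl⟩
  exact PadicInt.norm_lt_one_iff_dvd _ |>.mp h10

theorem iwahori_le_maximalCompact : iwahori q ≤ maximalCompact q := by
  rintro _ ⟨u, -, rfl⟩
  exact ⟨u, rfl⟩

theorem norm_lt_one_of_mem_iwahori {g : GL (Fin 2) ℚ_[q]} (hg : g ∈ iwahori q) : ‖g 1 0‖ < 1 := by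
  obtain ⟨u, hu, rfl⟩ := hg
  exact PadicInt.norm_lt_one_iff_dvd _ |>.mpr hu

theorem centerIwahori_le_centerMaximal : centerIwahori q ≤ centerMaximal q :=
  sup_le_sup_left iwahori_le_maximalCompact _

theorem boundedModCenter_of_mem_centerMaximal {g : GL (Fin 2) ℚ_[q]} (hg : g ∈ centerMaximal q) :
    BoundedModCenter 1 g := by
  obtain ⟨z, hz, k, hk, rfl⟩ := Subgroup.mem_sup_of_normal_left.mp hg
  obtain ⟨h1, h2⟩ := integral_of_mem_maximalCompact hk
  have hk1 : BoundedModCenter 1 k := by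
    intro i j k' l
    rw [h2, mul_one]
    exact mul_le_one₀ (h1 _ _) (norm_nonneg _) (h1 _ _)
  simpa using (boundedModCenter_of_mem_center hz).mul hk1

/-- A form of the divisibility of the lower left entry that is homogeneous of degree `2`, and
therefore survives multiplication by the centre. -/
theorem norm_lt_of_mem_centerIwahori {g : GL (Fin 2) ℚ_[q]} (hg : g ∈ centerIwahori q)
    (i j : Fin 2) : ‖g 1 0‖ * ‖g i j‖ < ‖(g : Matrix (Fin 2) (Fin 2) ℚ_[q]).det‖ := by
  obtain ⟨z, hz, k, hk, rfl⟩ := Subgroup.mem_sup_of_normal_left.mp hg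
  obtain ⟨h1, h2⟩ := integral_of_mem_maximalCompact (iwahori_le_maximalCompact hk)
  have h3 := norm_lt_one_of_mem_iwahori hk
  have hpos := norm_det_pos z
  obtain ⟨r, hr⟩ := mem_center_apply hz
  have h4 (i j) : (z * k) i j = r * k i j := by
    rw [Units.val_mul, hr, Matrix.mul_apply, Fin.sum_univ_two]
    fin_cases i <;> simp
  rw [hr, Matrix.det_fin_two_of] at hpos
  rw [h4, h4, Units.val_mul, Matrix.det_mul, norm_mul _ (k : Matrix (Fin 2) (Fin 2) ℚ_[q]).det, h2,
    hr, Matrix.det_fin_two_of]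
  simp only [norm_mul, mul_zero, sub_zero, mul_one] at hpos ⊢
  calc ‖r‖ * ‖k 1 0‖ * (‖r‖ * ‖k i j‖) = ‖r‖ * ‖r‖ * (‖k 1 0‖ * ‖k i j‖) := by ring
    _ < ‖r‖ * ‖r‖ * 1 := by
      refine mul_lt_mul_of_pos_left ?_ hpos
      exact mul_lt_one_of_nonneg_of_lt_one_left (norm_nonneg _) h3 (h1 _ _)
    _ = _ := mul_one _

theorem isOpen_centerIwahori : IsOpen (centerIwahori q : Set (GL (Fin 2) ℚ_[q])) := by
  let U : Set (GL (Fin 2) ℚ_[q]) := {g | (∀ i j, ‖g i j‖ ≤ 1) ∧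
    ‖(g : Matrix (Fin 2) (Fin 2) ℚ_[q]).det‖ = 1 ∧ ‖g 1 0‖ < 1}
  have hc (i j : Fin 2) : Continuous fun g : GL (Fin 2) ℚ_[q] => g i j :=
    Units.continuous_val.matrix_elem i j
  have hU : IsOpen U := by
    have h1 (i j : Fin 2) : IsOpen {g : GL (Fin 2) ℚ_[q] | ‖g i j‖ ≤ 1} := by
      have := (IsUltrametricDist.isOpen_closedBall (0 : ℚ_[q]) one_ne_zero).preimage (hc i j)
      convert this using 1
      ext g
      simp
    have h2 : IsOpen {g : GL (Fin 2) ℚ_[q] | ‖(g : Matrix (Fin 2) (Fin 2) ℚ_[q]).det‖ = 1} := by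
      have := (IsUltrametricDist.isOpen_sphere (0 : ℚ_[q]) one_ne_zero).preimage
        (Units.continuous_val.matrix_det : Continuous fun g : GL (Fin 2) ℚ_[q] =>
          (g : Matrix (Fin 2) (Fin 2) ℚ_[q]).det)
      convert this using 1
      ext g
      simp
    have h3 : IsOpen {g : GL (Fin 2) ℚ_[q] | ‖g 1 0‖ < 1} :=
      isOpen_lt (hc 1 0).norm continuous_const
    have : U = (⋂ i, ⋂ j, {g : GL (Fin 2) ℚ_[q] | ‖g i j‖ ≤ 1}) ∩
        ({g : GL (Fin 2) ℚ_[q] | ‖(g : Matrix (Fin 2) (Fin 2) ℚ_[q]).det‖ = 1} ∩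
          {g : GL (Fin 2) ℚ_[q] | ‖g 1 0‖ < 1}) := by
      ext g
      simp [U]
    rw [this]
    exact (isOpen_iInter_of_finite fun i => isOpen_iInter_of_finite fun j => h1 i j).inter
      (h2.inter h3)
  -- A subgroup is open once it contains a neighbourhood of `1`; here `U` is one, by the ultrametric
  -- topology.
  refine Subgroup.isOpen_of_mem_nhds _ (g := 1) (Filter.mem_of_superset (hU.mem_nhds ?_) ?_)
  · refine ⟨fun i j => ?_, by simp, by simp⟩
    fin_cases i <;> fin_cases j <;> simp
  · intro g hg
    exact Subgroup.mem_sup_right (mem_iwahori_of_integral hg.1 hg.2.1 hg.2.2)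

/-! ### Local test functions -/

/-- Bounded functions on `GL₂(ℚ_q)` that are supported in the matrices bounded by `M` modulo the
centre, and right invariant under `Z_q K_0(q)`. -/
structure IsLocalTest (f : GL (Fin 2) ℚ_[q] → ℂ) (M : ℝ) : Prop where
  bounded : ∃ B, ∀ g, ‖f g‖ ≤ B
  support : ∀ g, f g ≠ 0 → BoundedModCenter M g
  invariant : ∀ g, ∀ h ∈ centerIwahori q, f (g * h) = f g

theorem IsLocalTest.mono {f : GL (Fin 2) ℚ_[q] → ℂ} {M M' : ℝ} (hf : IsLocalTest f M)
    (h : M ≤ M') : IsLocalTest f M' :=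
  ⟨hf.bounded, fun g hg => (hf.support g hg).mono h, hf.invariant⟩

theorem IsLocalTest.zero (M : ℝ) : IsLocalTest (0 : GL (Fin 2) ℚ_[q] → ℂ) M :=
  ⟨⟨0, by simp⟩, by simp, by simp⟩

theorem IsLocalTest.add {f₁ f₂ : GL (Fin 2) ℚ_[q] → ℂ} {M₁ M₂ : ℝ} (h₁ : IsLocalTest f₁ M₁)
    (h₂ : IsLocalTest f₂ M₂) : IsLocalTest (f₁ + f₂) (max M₁ M₂) := by
  obtain ⟨B₁, hB₁⟩ := h₁.bounded
  obtain ⟨B₂, hB₂⟩ := h₂.bounded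
  refine ⟨⟨B₁ + B₂, fun g => (norm_add_le _ _).trans (add_le_add (hB₁ g) (hB₂ g))⟩,
    fun g hg => ?_, fun g h hh => ?_⟩
  · by_cases h : f₁ g = 0
    · exact (h₂.support g fun h' => hg (by simp [h, h'])).mono (le_max_right _ _)
    · exact (h₁.support g h).mono (le_max_left _ _)
  · simp [h₁.invariant g h hh, h₂.invariant g h hh]

theorem IsLocalTest.smul {f : GL (Fin 2) ℚ_[q] → ℂ} {M : ℝ} (h : IsLocalTest f M) (c : ℂ) :
    IsLocalTest (c • f) M := by
  obtain ⟨B, hB⟩ := h.bounded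
  refine ⟨⟨‖c‖ * B, fun g => ?_⟩, fun g hg => h.support g fun h' => hg (by simp [h']),
    fun g k hk => by simp [h.invariant g k hk]⟩
  simpa using mul_le_mul_of_nonneg_left (hB g) (norm_nonneg c)

theorem exists_isLocalTest_sum {ι : Type*} (s : Finset ι) (f : ι → GL (Fin 2) ℚ_[q] → ℂ)
    (h : ∀ i, ∃ M, IsLocalTest (f i) M) : ∃ M, IsLocalTest (∑ i ∈ s, f i) M := by
  classical
  induction s using Finset.induction_on with
  | empty => exact ⟨0, by simpa using IsLocalTest.zero 0⟩
  | insert i s hi ih =>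
    obtain ⟨M₁, h₁⟩ := h i
    obtain ⟨M₂, h₂⟩ := ih
    exact ⟨_, by simpa [Finset.sum_insert hi] using h₁.add h₂⟩

theorem isLocalTest_indicator {S : Set (GL (Fin 2) ℚ_[q])} {M : ℝ} (c : ℂ)
    (hS : ∀ g ∈ S, BoundedModCenter M g)
    (hinv : ∀ g, ∀ h ∈ centerIwahori q, g * h ∈ S ↔ g ∈ S) :
    IsLocalTest (S.indicator fun _ => c) M := by
  classical
  refine ⟨⟨‖c‖, fun g => norm_indicator_le_norm_self (fun _ => c) g⟩,
    fun g hg => hS g (Set.mem_of_indicator_ne_zero hg), fun g h hh => ?_⟩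
  simp only [Set.indicator_apply, hinv g h hh]

theorem isLocalTest_unramifiedTest : IsLocalTest (unramifiedTest q) 1 :=
  isLocalTest_indicator _ (fun _ => boundedModCenter_of_mem_centerMaximal) fun _ _ hh =>
    Subgroup.mul_mem_cancel_right _ (centerIwahori_le_centerMaximal hh)

theorem isLocalTest_levelTest : IsLocalTest (levelTest q) 1 :=
  isLocalTest_indicator _ (fun _ hg =>
    boundedModCenter_of_mem_centerMaximal (centerIwahori_le_centerMaximal hg)) fun _ _ hh =>
    Subgroup.mul_mem_cancel_right _ hh

theorem exists_isLocalTest_ramifiedTest (χ : Ideles →* ℂˣ) (q : Nat.Primes) :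
    ∃ M, IsLocalTest (ramifiedTest χ q) M := by
  have h (j : ℕ) : ∃ M, IsLocalTest (fun g : GL (Fin 2) ℚ_[q] =>
      unramifiedTest q ((unipotent ((j : ℚ_[q]) / (q : ℚ_[q]) ^ conductorExponent χ q))⁻¹ * g)) M := by
    set u := unipotent ((j : ℚ_[q]) / (q : ℚ_[q]) ^ conductorExponent χ q)
    obtain ⟨M, hM⟩ := exists_boundedModCenter u
    -- Left translation by `u` multiplies the support bound by that of `u` and does not affect right
    -- invariance.
    refine ⟨M * 1, ?_⟩
    obtain ⟨B, hB⟩ := (isLocalTest_unramifiedTest (q := q)).bounded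
    refine ⟨⟨B, fun g => hB _⟩, fun g hg => ?_, fun g h hh => ?_⟩
    · have := hM.mul (isLocalTest_unramifiedTest.support _ hg)
      rwa [mul_inv_cancel_left] at this
    · rw [← mul_assoc]
      exact isLocalTest_unramifiedTest.invariant _ h hh
  obtain ⟨M, hM⟩ := exists_isLocalTest_sum
    (Finset.range ((q : ℕ) ^ conductorExponent χ q)) (fun (j : ℕ) =>
      twistWeight χ q ((j : ℚ_[q]) / (q : ℚ_[q]) ^ conductorExponent χ q) •
      fun g : GL (Fin 2) ℚ_[q] => unramifiedTest q
        ((unipotent ((j : ℚ_[q]) / (q : ℚ_[q]) ^ conductorExponent χ q))⁻¹ * g)) fun j => by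
      obtain ⟨M, hM⟩ := h j
      exact ⟨M, hM.smul _⟩
  refine ⟨M, ?_⟩
  convert hM.smul (gaussSum χ q)⁻¹ using 1
  ext g
  simp [ramifiedTest]

theorem exists_isLocalTest_of_mem_heckeAlgebra {f : GL (Fin 2) ℚ_[q] → ℂ}
    (hf : f ∈ heckeAlgebra q) : ∃ M, IsLocalTest f M := by
  induction hf using Submodule.span_induction with
  | mem f hf =>
    obtain ⟨g, rfl⟩ := hf
    obtain ⟨M, hM⟩ := exists_boundedModCenter g
    refine ⟨1 * M * 1, isLocalTest_indicator _ ?_ ?_⟩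
    · intro g' hg'
      obtain ⟨x, hx, y, hy, rfl⟩ := DoubleCoset.mem_doubleCoset.mp hg'
      exact ((boundedModCenter_of_mem_centerMaximal hx).mul hM).mul
        (boundedModCenter_of_mem_centerMaximal hy)
    · intro g' h hh
      have hh' := centerIwahori_le_centerMaximal hh
      simp only [DoubleCoset.mem_doubleCoset]
      constructor
      · rintro ⟨x, hx, y, hy, h1⟩
        exact ⟨x, hx, y * h⁻¹, mul_mem hy (inv_mem hh'), by rw [← mul_assoc, ← h1]; group⟩
      · rintro ⟨x, hx, y, hy, rfl⟩
        exact ⟨x, hx, y * h, mul_mem hy hh', by group⟩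
  | zero => exact ⟨0, IsLocalTest.zero 0⟩
  | add f g _ _ hf hg =>
    obtain ⟨M₁, h₁⟩ := hf
    obtain ⟨M₂, h₂⟩ := hg
    exact ⟨_, h₁.add h₂⟩
  | smul c f _ hf =>
    obtain ⟨M, hM⟩ := hf
    exact ⟨M, hM.smul c⟩

/-- Right invariance under an open subgroup makes `f` locally constant. -/
theorem IsLocalTest.continuous {f : GL (Fin 2) ℚ_[q] → ℂ} {M : ℝ} (hf : IsLocalTest f M) :
    Continuous f := by
  refine IsLocallyConstant.continuous ((IsLocallyConstant.iff_eventually_eq f).mpr fun g => ?_)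
  have h1 : (fun h => g⁻¹ * h) ⁻¹' (centerIwahori q : Set (GL (Fin 2) ℚ_[q])) ∈ 𝓝 g :=
    (isOpen_centerIwahori.preimage (continuous_const_mul _)).mem_nhds (by
      simp)
  filter_upwards [h1] with h hh
  simpa using hf.invariant g _ hh

/-! ### Local orbital functions -/

/-- The matrix `t_a⁻¹ ξ(x) t_b` over `ℚ_q`. -/
def orbitMatrix (x : RegularParam) (a b : ℚ_[q]ˣ) : GL (Fin 2) ℚ_[q] :=
  (torus a)⁻¹ * GeneralLinearGroup.map (Rat.castHom ℚ_[q]) (xi x) * torus b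

theorem torus_inv {F : Type*} [Field F] (a : Fˣ) : (torus a)⁻¹ = torus a⁻¹ := by
  rw [inv_eq_iff_mul_eq_one]
  ext i j
  fin_cases i <;> fin_cases j <;> simp [torus, GeneralLinearGroup.mkOfDetNeZero]

theorem coe_orbit {F : Type*} [Field F] [CharZero F] (x : RegularParam) (a b : Fˣ) :
    (((torus a)⁻¹ * GeneralLinearGroup.map (Rat.castHom F) (xi x) * torus b : GL (Fin 2) F) :
      Matrix (Fin 2) (Fin 2) F) =
      !![(a : F)⁻¹ * b, (a : F)⁻¹ * ((x : ℚ) : F); (b : F), 1] := by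
  rw [torus_inv]
  ext i j
  fin_cases i <;> fin_cases j <;>
    simp [torus, xi, GeneralLinearGroup.mkOfDetNeZero, Matrix.vecMul, dotProduct, Matrix.mul_apply,
      Fin.sum_univ_two]

theorem coe_orbitMatrix (x : RegularParam) (a b : ℚ_[q]ˣ) :
    (orbitMatrix x a b : Matrix (Fin 2) (Fin 2) ℚ_[q]) =
      !![(a : ℚ_[q])⁻¹ * b, (a : ℚ_[q])⁻¹ * ((x : ℚ) : ℚ_[q]); (b : ℚ_[q]), 1] :=
  coe_orbit x a b

theorem det_orbitMatrix (x : RegularParam) (a b : ℚ_[q]ˣ) :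
    (orbitMatrix x a b : Matrix (Fin 2) (Fin 2) ℚ_[q]).det =
      (a : ℚ_[q])⁻¹ * b * (1 - ((x : ℚ) : ℚ_[q])) := by
  rw [coe_orbitMatrix, Matrix.det_fin_two_of]
  ring

theorem continuous_torus : Continuous (torus : ℚ_[q]ˣ → GL (Fin 2) ℚ_[q]) := by
  have h2 : Continuous fun a : ℚ_[q]ˣ => ((torus a : GL (Fin 2) ℚ_[q]) : Matrix (Fin 2) (Fin 2) ℚ_[q]) := by
    refine continuous_matrix fun i j => ?_
    fin_cases i <;> fin_cases j <;>
      simp [torus, GeneralLinearGroup.mkOfDetNeZero, Units.continuous_val, continuous_const]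
  refine Units.continuous_iff.mpr ⟨h2, ?_⟩
  simp only [torus_inv]
  exact h2.comp continuous_inv

theorem continuous_orbitMatrix (x : RegularParam) {X : Type*} [TopologicalSpace X]
    {f g : X → ℚ_[q]ˣ} (hf : Continuous f) (hg : Continuous g) :
    Continuous fun t => orbitMatrix x (f t) (g t) :=
  ((continuous_torus.comp hf).inv.mul continuous_const).mul (continuous_torus.comp hg)

/-- The diagonal entries multiply to `b / a`, while the determinant is `(b / a)(1 - x)`; cancelling
`b / a` leaves a condition on `x` alone. It bounds the denominator of `(1 - x)⁻¹` locally. -/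
theorem one_le_of_boundedModCenter {M : ℝ} {x : RegularParam} {a b : ℚ_[q]ˣ}
    (h : BoundedModCenter M (orbitMatrix x a b)) : 1 ≤ M * ‖1 - ((x : ℚ) : ℚ_[q])‖ := by
  have h1 := h 0 0 1 1
  rw [det_orbitMatrix, coe_orbitMatrix] at h1
  simp only [Matrix.of_apply, Matrix.cons_val', Matrix.cons_val_zero, Matrix.cons_val_one,
    Matrix.cons_val_fin_one, norm_one, mul_one, norm_mul] at h1
  have h2 : 0 < ‖(a : ℚ_[q])⁻¹‖ * ‖(b : ℚ_[q])‖ := by simp [norm_pos_iff]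
  rw [← norm_mul] at h1 h2
  nlinarith

/-- The squares of the four entries, compared with the determinant, confine `a` and `b` to annuli
depending on `x`. These give compact support in the ideles, and exactly the units when all constants
are `1`. -/
theorem norm_le_of_boundedModCenter {M : ℝ} {x : RegularParam} {a b : ℚ_[q]ˣ}
    (h : BoundedModCenter M (orbitMatrix x a b)) :
    (‖(a : ℚ_[q])‖ ≤ M * ‖1 - ((x : ℚ) : ℚ_[q])‖ ∧
      ‖((x : ℚ) : ℚ_[q])‖ ≤ M * ‖1 - ((x : ℚ) : ℚ_[q])‖ * ‖(a : ℚ_[q])‖) ∧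
    ‖(b : ℚ_[q])‖ ≤ M * ‖1 - ((x : ℚ) : ℚ_[q])‖ ∧
      ‖((x : ℚ) : ℚ_[q])‖ ≤ M * ‖1 - ((x : ℚ) : ℚ_[q])‖ * ‖(b : ℚ_[q])‖ := by
  have h1 := h 0 0 0 0
  have h2 := h 1 1 1 1
  have h3 := h 1 0 1 0
  have h4 := h 0 1 0 1
  have hW := one_le_of_boundedModCenter h
  rw [det_orbitMatrix, coe_orbitMatrix] at h1 h2 h3 h4
  simp only [Matrix.of_apply, Matrix.cons_val', Matrix.cons_val_zero, Matrix.cons_val_one,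
    Matrix.cons_val_fin_one, norm_one, mul_one, norm_mul, norm_inv] at h1 h2 h3 h4
  have ha : 0 < ‖(a : ℚ_[q])‖ := norm_pos_iff.mpr a.ne_zero
  have hb : 0 < ‖(b : ℚ_[q])‖ := norm_pos_iff.mpr b.ne_zero
  have hx : 0 ≤ ‖((x : ℚ) : ℚ_[q])‖ := norm_nonneg _
  generalize ‖(a : ℚ_[q])‖ = α at *
  generalize ‖(b : ℚ_[q])‖ = β at *
  generalize ‖((x : ℚ) : ℚ_[q])‖ = ξ at *
  set W := M * ‖1 - ((x : ℚ) : ℚ_[q])‖ with hWdef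
  have e1 : β ≤ W * α := by
    have : α⁻¹ * β * (α⁻¹ * β) ≤ W * (α⁻¹ * β) := by rw [hWdef]; linarith
    have := le_of_mul_le_mul_right this (by positivity)
    rwa [inv_mul_le_iff₀ ha, mul_comm] at this
  have e2 : α ≤ W * β := by
    have : 1 ≤ α⁻¹ * (W * β) := by rw [hWdef]; linarith
    rwa [le_inv_mul_iff₀ ha, mul_one] at this
  have e3 : α * β ≤ W := by
    have : β * β ≤ (α⁻¹ * W) * β := by rw [hWdef]; linarith
    have := le_of_mul_le_mul_right this hb
    rwa [le_inv_mul_iff₀ ha] at this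
  have e4 : ξ * ξ ≤ W * (α * β) := by
    have h5 : α⁻¹ * ξ * (α⁻¹ * ξ) ≤ W * (α⁻¹ * β) := by rw [hWdef]; linarith
    have h6 := mul_le_mul_of_nonneg_left h5 (mul_pos ha ha).le
    have h7 : α * α * (α⁻¹ * ξ * (α⁻¹ * ξ)) = ξ * ξ := by field_simp
    have h8 : α * α * (W * (α⁻¹ * β)) = W * (α * β) := by field_simp
    linarith
  have hW0 : 0 < W := by linarith
  -- Upper bounds: `α² ≤ W α β ≤ W²`. Lower bounds: `ξ² ≤ W α β ≤ W² α²`. The same holds with `α`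
  -- and `β` exchanged.
  refine ⟨⟨?_, ?_⟩, ?_, ?_⟩
  · refine abs_le_of_sq_le_sq' ?_ hW0.le |>.2
    nlinarith
  · refine abs_le_of_sq_le_sq' ?_ (by positivity) |>.2
    nlinarith [mul_pos hW0 ha]
  · refine abs_le_of_sq_le_sq' ?_ hW0.le |>.2
    nlinarith
  · refine abs_le_of_sq_le_sq' ?_ (by positivity) |>.2
    nlinarith [mul_pos hW0 hb]

/-- The off-diagonal entries multiply to `(b / a) x`, so cancelling `b / a` again isolates `x`. This
is how the level enters. -/
theorem norm_lt_of_orbitMatrix_mem_centerIwahori {x : RegularParam} {a b : ℚ_[q]ˣ}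
    (h : orbitMatrix x a b ∈ centerIwahori q) :
    ‖((x : ℚ) : ℚ_[q])‖ < ‖1 - ((x : ℚ) : ℚ_[q])‖ := by
  have h1 := norm_lt_of_mem_centerIwahori h 0 1
  rw [det_orbitMatrix, coe_orbitMatrix] at h1
  simp only [Matrix.of_apply, Matrix.cons_val', Matrix.cons_val_zero, Matrix.cons_val_one,
    Matrix.cons_val_fin_one, norm_mul] at h1
  have h2 : 0 < ‖(a : ℚ_[q])⁻¹‖ * ‖(b : ℚ_[q])‖ := by simp [norm_pos_iff]
  refine lt_of_mul_lt_mul_left ?_ h2.le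
  linarith

theorem unramifiedTest_orbitMatrix {x : RegularParam} (hx : ‖((x : ℚ) : ℚ_[q])‖ = 1)
    (hx' : ‖1 - ((x : ℚ) : ℚ_[q])‖ = 1) {a b : ℚ_[q]ˣ} (ha : a ∈ padicUnits q)
    (hb : b ∈ padicUnits q) : unramifiedTest q (orbitMatrix x a b) = 1 := by
  have ha' : ‖(a : ℚ_[q])‖ = 1 := ha
  have hb' : ‖(b : ℚ_[q])‖ = 1 := hb
  refine Set.indicator_of_mem (Subgroup.mem_sup_right (mem_maximalCompact_of_integral ?_ ?_)) _
  · intro i j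
    rw [coe_orbitMatrix]
    fin_cases i <;> fin_cases j <;> simp [ha', hb', hx]
  · rw [det_orbitMatrix]
    simp [ha', hb', hx']

theorem mem_padicUnits_of_unramifiedTest_ne_zero {x : RegularParam} (hx : ‖((x : ℚ) : ℚ_[q])‖ = 1)
    (hx' : ‖1 - ((x : ℚ) : ℚ_[q])‖ = 1) {a b : ℚ_[q]ˣ}
    (h : unramifiedTest q (orbitMatrix x a b) ≠ 0) : a ∈ padicUnits q ∧ b ∈ padicUnits q := by
  obtain ⟨⟨h1, h2⟩, h3, h4⟩ :=
    norm_le_of_boundedModCenter (isLocalTest_unramifiedTest.support _ h)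
  rw [hx, hx'] at *
  simp only [one_mul] at *
  exact ⟨le_antisymm h1 h2, le_antisymm h3 h4⟩

end Local

/-! ### Topology of the finite ideles -/

instance instSecondCountablePadicUnitGroup (q : Nat.Primes) : SecondCountableTopology ℚ_[q]ˣ :=
  Units.isEmbedding_val₀.secondCountableTopology

theorem mem_integralIdeles {a : FiniteIdeles} :
    a ∈ (integralIdeles : Set FiniteIdeles) ↔ ∀ q, a q ∈ padicUnits q := by
  constructor
  · rintro ⟨u, rfl⟩ q
    exact (u q).2
  · intro h
    exact ⟨fun q => ⟨a q, h q⟩, rfl⟩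

theorem isOpen_integralIdeles : IsOpen (integralIdeles : Set FiniteIdeles) :=
  (RestrictedProduct.isOpenEmbedding_structureMap isOpen_padicUnits).isOpen_range

/-- The idele with components `q ^ e q`. -/
def primePowerIdele (e : Nat.Primes →₀ ℤ) : FiniteIdeles :=
  RestrictedProduct.mk (fun q => (Units.mk0 ((q : ℕ) : ℚ_[q]) (by
    exact_mod_cast q.2.ne_zero)) ^ e q) (by
      filter_upwards [e.support.finite_toSet.compl_mem_cofinite] with q hq
      have : e q = 0 := by simpa using hq
      simp [this])

theorem norm_primePowerIdele (e : Nat.Primes →₀ ℤ) (q : Nat.Primes) :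
    ‖(primePowerIdele e q : ℚ_[q])‖ = ((q : ℕ) : ℝ) ^ (-e q) := by
  change ‖((Units.mk0 ((q : ℕ) : ℚ_[q]) _ ^ e q : ℚ_[q]ˣ) : ℚ_[q])‖ = _
  simp

theorem exists_primePowerIdele (a : FiniteIdeles) :
    ∃ e : Nat.Primes →₀ ℤ, (∀ q : Nat.Primes, ‖(a q : ℚ_[q])‖ = ((q : ℕ) : ℝ) ^ (-e q)) ∧
      (primePowerIdele e)⁻¹ * a ∈ (integralIdeles : Set FiniteIdeles) := by
  have hne (q : Nat.Primes) : ((q : ℕ) : ℝ) ≠ 0 := by exact_mod_cast q.2.ne_zero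
  have hfin : {q : Nat.Primes | (a q : ℚ_[q]).valuation ≠ 0}.Finite := by
    have h := a.eventually
    rw [Filter.eventually_cofinite] at h
    refine h.subset fun q hq hmem => hq ?_
    have h1 : ‖(a q : ℚ_[q])‖ = 1 := hmem
    rw [Padic.norm_eq_zpow_neg_valuation (a q).ne_zero] at h1
    have h2 : (1 : ℝ) < ((q : ℕ) : ℝ) := by exact_mod_cast q.2.one_lt
    have := zpow_right_injective₀ (zero_lt_one.trans h2) h2.ne' (h1.trans (zpow_zero _).symm)
    simpa using this
  have hnorm (q : Nat.Primes) : ‖(a q : ℚ_[q])‖ =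
      ((q : ℕ) : ℝ) ^ (-(a q : ℚ_[q]).valuation) :=
    Padic.norm_eq_zpow_neg_valuation (a q).ne_zero
  refine ⟨Finsupp.ofSupportFinite (fun q => (a q : ℚ_[q]).valuation) hfin, hnorm, ?_⟩
  rw [mem_integralIdeles]
  intro q
  change ‖((((primePowerIdele _)⁻¹ * a) q : ℚ_[q]ˣ) : ℚ_[q])‖ = 1
  rw [RestrictedProduct.mul_apply, RestrictedProduct.inv_apply, Units.val_mul, norm_mul,
    Units.val_inv_eq_inv_val, norm_inv, norm_primePowerIdele, hnorm]
  exact inv_mul_cancel₀ (zpow_ne_zero _ (hne q))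

theorem mem_mulLeft_image {t a : FiniteIdeles} {S : Set FiniteIdeles} :
    a ∈ Homeomorph.mulLeft t '' S ↔ t⁻¹ * a ∈ S := by
  constructor
  · rintro ⟨u, hu, rfl⟩
    simpa using hu
  · intro h
    exact ⟨_, h, by simp⟩

/-- Countably many open translates of `∏_q ℤ_q^*`, one per finitely supported exponent vector, cover
the finite ideles. Second countability makes the Borel structure compatible with products and the
Haar measure σ-finite. -/
instance instSecondCountableFiniteIdeles : SecondCountableTopology FiniteIdeles := by
  have h0 : SecondCountableTopology (integralIdeles : Set FiniteIdeles) :=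
    ((RestrictedProduct.isOpenEmbedding_structureMap
      isOpen_padicUnits).isEmbedding.toHomeomorph).symm.secondCountableTopology
  have h1 (e : Nat.Primes →₀ ℤ) : SecondCountableTopology
      (Homeomorph.mulLeft (primePowerIdele e) '' (integralIdeles : Set FiniteIdeles)) :=
    ((Homeomorph.mulLeft (primePowerIdele e)).image _).symm.secondCountableTopology
  refine TopologicalSpace.secondCountableTopology_of_countable_cover
    (U := fun e => Homeomorph.mulLeft (primePowerIdele e) '' (integralIdeles : Set FiniteIdeles))
    (fun e => (Homeomorph.mulLeft _).isOpenMap _ isOpen_integralIdeles) ?_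
  refine Set.eq_univ_of_forall fun a => Set.mem_iUnion.mpr ?_
  obtain ⟨e, -, he⟩ := exists_primePowerIdele a
  exact ⟨e, mem_mulLeft_image.mpr he⟩

/-- Finite ideles that are units outside a finite set, with bounded components, lie in a compact
set. -/
theorem exists_isCompact_of_bounded (T : Finset Nat.Primes) (R : Nat.Primes → ℝ) :
    ∃ K : Set FiniteIdeles, IsCompact K ∧ ∀ a : FiniteIdeles,
      (∀ q ∉ T, a q ∈ padicUnits q) →
      (∀ q ∈ T, ‖(a q : ℚ_[q])‖ ≤ R q ∧ 1 ≤ R q * ‖(a q : ℚ_[q])‖) → a ∈ K := by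
  have hone (q : Nat.Primes) : (1 : ℝ) < ((q : ℕ) : ℝ) := by exact_mod_cast q.2.one_lt
  have hn (q : Nat.Primes) : ∃ n : ℕ, R q < ((q : ℕ) : ℝ) ^ n := pow_unbounded_of_one_lt _ (hone q)
  choose n hn using hn
  -- The two bounds at `q ∈ T` give `q ^ (-e q) < q ^ n q` and `q ^ e q < q ^ n q`, so only finitely
  -- many exponent vectors, hence finitely many compact translates, occur.
  let E : Finset (Nat.Primes →₀ ℤ) := Finset.finsupp T fun q => Finset.Icc (-(n q : ℤ)) (n q)
  refine ⟨⋃ e ∈ E, Homeomorph.mulLeft (primePowerIdele e) '' (integralIdeles : Set FiniteIdeles),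
    E.isCompact_biUnion fun e _ => integralIdeles.isCompact.image (Homeomorph.mulLeft _).continuous,
    fun a h1 h2 => ?_⟩
  obtain ⟨e, he, hmem⟩ := exists_primePowerIdele a
  refine Set.mem_biUnion (x := e) ?_ (mem_mulLeft_image.mpr hmem)
  refine Finset.mem_finsupp_iff.mpr ⟨fun q hq => ?_, fun q hq => ?_⟩
  · by_contra hqT
    have h3 : ‖(a q : ℚ_[q])‖ = 1 := h1 q hqT
    rw [he q] at h3
    have := zpow_right_injective₀ (zero_lt_one.trans (hone q)) (hone q).ne'
      (h3.trans (zpow_zero _).symm)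
    exact Finsupp.mem_support_iff.mp hq (by simpa using this)
  · obtain ⟨h3, h4⟩ := h2 q hq
    rw [he q] at h3 h4
    have h5 : ((q : ℕ) : ℝ) ^ (-e q) < ((q : ℕ) : ℝ) ^ (n q : ℤ) := by
      rw [zpow_natCast]
      exact h3.trans_lt (hn q)
    have hpos : (0 : ℝ) < ((q : ℕ) : ℝ) ^ (-e q) := zpow_pos (zero_lt_one.trans (hone q)) _
    have h6 : ((q : ℕ) : ℝ) ^ (e q) < ((q : ℕ) : ℝ) ^ (n q : ℤ) := by
      rw [zpow_natCast]
      refine lt_of_le_of_lt ?_ (hn q)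
      rw [_root_.zpow_neg] at h4 hpos
      rwa [← div_eq_mul_inv, one_le_div (inv_pos.mp hpos)] at h4
    have h7 := (zpow_lt_zpow_iff_right₀ (hone q)).mp h5
    have h8 := (zpow_lt_zpow_iff_right₀ (hone q)).mp h6
    exact Finset.mem_Icc.mpr ⟨by omega, by omega⟩

/-! ### The norm of a finite idele -/

/-- The norm `∏_q |a_q|_q` of a finite idele. -/
def finiteNorm (a : FiniteIdeles) : ℝ := ∏ᶠ q : Nat.Primes, ‖(a q : ℚ_[q])‖

theorem finiteNorm_pos (a : FiniteIdeles) : 0 < finiteNorm a :=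
  finprod_induction (p := fun r : ℝ => 0 < r) one_pos (fun _ _ => mul_pos) fun q =>
    norm_pos_iff.mpr (a q).ne_zero

/-- The norm is constant on cosets of the open subgroup `∏_q ℤ_q^*`. -/
theorem continuous_finiteNorm : Continuous finiteNorm := by
  refine IsLocallyConstant.continuous ((IsLocallyConstant.iff_eventually_eq _).mpr fun a => ?_)
  have h1 : (fun b => a⁻¹ * b) ⁻¹' (integralIdeles : Set FiniteIdeles) ∈ 𝓝 a :=
    (isOpen_integralIdeles.preimage (continuous_const_mul _)).mem_nhds (by
      simp only [Set.mem_preimage, inv_mul_cancel, mem_integralIdeles]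
      exact fun q => one_mem _)
  filter_upwards [h1] with b hb
  refine finprod_congr fun q => ?_
  have h2 : ‖(((a⁻¹ * b) q : ℚ_[q]ˣ) : ℚ_[q])‖ = 1 := mem_integralIdeles.mp hb q
  rw [RestrictedProduct.mul_apply, RestrictedProduct.inv_apply, Units.val_mul, norm_mul,
    Units.val_inv_eq_inv_val, norm_inv] at h2
  have h3 : ‖(a q : ℚ_[q])‖ ≠ 0 := norm_ne_zero_iff.mpr (a q).ne_zero
  field_simp at h2
  exact h2

theorem ideleNorm_eq (a : Ideles) : ideleNorm a = |(a.1 : ℝ)| * finiteNorm a.2 := rfl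

theorem ideleNorm_pos (a : Ideles) : 0 < ideleNorm a :=
  mul_pos (abs_pos.mpr a.1.ne_zero) (finiteNorm_pos _)

/-! ### Quadratic characters -/

/-- A neighbourhood of `1` in `∏_q ℤ_q^*` on which `χ ≠ -1` restricts only finitely many
coordinates. At any other prime the local units avoid the value `-1`, and a quadratic character has
only the values `±1`. -/
theorem finite_setOf_isRamifiedAt {χ : Ideles →* ℂˣ} (hχ : Continuous χ)
    (hquad : ∀ a, χ a ^ 2 = 1) : {q | IsRamifiedAt χ q}.Finite := by
  let φ : (∀ q : Nat.Primes, (padicUnits q : Set ℚ_[q]ˣ)) → ℂ := fun u =>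
    (χ (1, RestrictedProduct.structureMap (fun q : Nat.Primes => ℚ_[q]ˣ)
      (fun q => (padicUnits q : Set ℚ_[q]ˣ)) cofinite u) : ℂ)
  have hφ : Continuous φ := Units.continuous_val.comp (hχ.comp
    (continuous_const.prodMk RestrictedProduct.isEmbedding_structureMap.continuous))
  have hopen : IsOpen (φ ⁻¹' {-1}ᶜ) := isOpen_compl_singleton.preimage hφ
  let u₁ : ∀ q : Nat.Primes, (padicUnits q : Set ℚ_[q]ˣ) := fun q => ⟨1, one_mem (padicUnits q)⟩
  have h1 : u₁ ∈ φ ⁻¹' {-1}ᶜ := by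
    have h : φ u₁ = 1 := by
      have : RestrictedProduct.structureMap (fun q : Nat.Primes => ℚ_[q]ˣ)
          (fun q => (padicUnits q : Set ℚ_[q]ˣ)) cofinite u₁ = 1 := rfl
      simp only [φ, this]
      exact congrArg Units.val (map_one χ)
    simp only [Set.mem_preimage, Set.mem_compl_iff, Set.mem_singleton_iff, h]
    norm_num
  obtain ⟨T, V, hV, hsub⟩ := isOpen_pi_iff.mp hopen u₁ h1
  refine T.finite_toSet.subset fun q hq => ?_
  by_contra hqT
  refine hq fun u hu => ?_
  classical
  let w : ∀ q : Nat.Primes, (padicUnits q : Set ℚ_[q]ˣ) := Function.update u₁ q ⟨u, hu⟩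
  have hw : w ∈ φ ⁻¹' {-1}ᶜ := by
    refine hsub fun i hi => ?_
    have : i ≠ q := fun h => hqT (h ▸ hi)
    simpa [w, this] using (hV i hi).2
  have hw' : φ w = (localChar χ q u : ℂ) := by
    have : RestrictedProduct.structureMap (fun q : Nat.Primes => ℚ_[q]ˣ)
        (fun q => (padicUnits q : Set ℚ_[q]ˣ)) cofinite w =
        RestrictedProduct.mulSingle padicUnits q u := by
      ext i
      by_cases hi : i = q
      · subst hi
        simp [w]
      · rw [RestrictedProduct.mulSingle_eq_of_ne _ _ hi]
        simp [w, hi, u₁]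
    simp only [φ, this, localChar]
  have hne : (localChar χ q u : ℂ) ≠ -1 := by
    rw [← hw']
    exact hw
  have hsq : (localChar χ q u : ℂ) ^ 2 = 1 := by
    rw [← Units.val_pow_eq_pow_val, localChar, hquad, Units.val_one]
  rw [sq] at hsq
  exact Units.ext ((mul_self_eq_one_iff.mp hsq).resolve_right hne)

/-- Positive reals are squares, so a quadratic character is trivial on them and is determined by its
value at `-1`. -/
theorem realChar_eq {χ : Ideles →* ℂˣ} (hquad : ∀ a, χ a ^ 2 = 1) (hodd : realChar χ (-1) = -1)
    (u : ℝˣ) : (realChar χ u : ℂ) = (((u : ℝ) / |(u : ℝ)| : ℝ) : ℂ) := by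
  have hpos (v : ℝˣ) (hv : 0 < (v : ℝ)) : realChar χ v = 1 := by
    have h1 : v = (Units.mk0 (√(v : ℝ)) (Real.sqrt_pos.mpr hv).ne') ^ 2 := by
      ext
      simp [Real.sq_sqrt hv.le]
    rw [h1]
    have : ((Units.mk0 (√(v : ℝ)) (Real.sqrt_pos.mpr hv).ne') ^ 2, (1 : FiniteIdeles)) =
        ((Units.mk0 (√(v : ℝ)) (Real.sqrt_pos.mpr hv).ne'), (1 : FiniteIdeles)) ^ 2 := by
      rw [Prod.pow_mk, one_pow]
    rw [realChar, this, map_pow]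
    exact hquad _
  rcases lt_or_gt_of_ne u.ne_zero with h | h
  · have h1 : ((u : ℝˣ), (1 : FiniteIdeles)) = ((-1 : ℝˣ), (1 : FiniteIdeles)) * (-u, 1) := by
      simp
    rw [realChar, h1, map_mul]
    have h2 := hpos (-u) (by simpa using h)
    rw [realChar] at h2 hodd
    rw [h2, hodd, abs_of_neg h, div_neg, div_self u.ne_zero]
    simp
  · rw [hpos u h, abs_of_pos h, div_self u.ne_zero]
    simp

theorem apply_eq_realChar_mul (χ : Ideles →* ℂˣ) (a : Ideles) :
    (χ a : ℂ) = realChar χ a.1 * χ (1, a.2) := by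
  rw [realChar, ← Units.val_mul, ← map_mul]
  simp

theorem norm_apply_eq_one {χ : Ideles →* ℂˣ} (hquad : ∀ a, χ a ^ 2 = 1) (a : Ideles) :
    ‖(χ a : ℂ)‖ = 1 := by
  have h : (χ a : ℂ) ^ 2 = 1 := by rw [← Units.val_pow_eq_pow_val, hquad, Units.val_one]
  have h2 : ‖(χ a : ℂ)‖ ^ 2 = 1 := by rw [← norm_pow, h, norm_one]
  exact (pow_eq_one_iff_of_nonneg (norm_nonneg _) two_ne_zero).mp h2

/-! ### The real place -/

theorem measurable_unitsVal : Measurable (Units.val : ℝˣ → ℝ) := comap_measurable _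

theorem measurableEmbedding_unitsVal : MeasurableEmbedding (Units.val : ℝˣ → ℝ) where
  injective := Units.val_injective
  measurable := measurable_unitsVal
  measurableSet_image' := by
    rintro _ ⟨T, hT, rfl⟩
    rw [Set.image_preimage_eq_inter_range]
    refine hT.inter ?_
    have : Set.range (Units.val : ℝˣ → ℝ) = {0}ᶜ := by
      ext r
      constructor
      · rintro ⟨u, rfl⟩
        exact u.ne_zero
      · intro hr
        exact ⟨Units.mk0 r hr, rfl⟩
    rw [this]
    exact (measurableSet_singleton _).compl

instance instSigmaFiniteRealUnitsMeasure : SigmaFinite realUnitsMeasure := by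
  have h : SigmaFinite (realUnitsMeasure.map Units.val) := by
    rw [realUnitsMeasure, measurableEmbedding_unitsVal.map_comap]
    have := SigmaFinite.withDensity_ofReal (μ := (volume : Measure ℝ)) (fun x : ℝ => |x|⁻¹)
    infer_instance
  exact SigmaFinite.of_map _ measurable_unitsVal.aemeasurable h

theorem realUnitsMeasure_apply {A : Set ℝˣ} (hA : MeasurableSet A) :
    realUnitsMeasure A = ∫⁻ x in Units.val '' A, ENNReal.ofReal |x|⁻¹ := by
  rw [realUnitsMeasure, measurableEmbedding_unitsVal.comap_apply,
    withDensity_apply _ (measurableEmbedding_unitsVal.measurableSet_image.mpr hA)]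

theorem measurable_const_mul_inv (c : ℝˣ) : Measurable fun u : ℝˣ => c * u⁻¹ := by
  refine measurable_comap_iff.mpr ?_
  have : (Units.val ∘ fun u : ℝˣ => c * u⁻¹) = fun u : ℝˣ => (c : ℝ) * (u : ℝ)⁻¹ := by
    ext u
    simp
  rw [this]
  exact measurable_unitsVal.inv.const_mul _

/-- The Jacobian of `t ↦ c / t` is `|c| / t²`, and `(|c| / t²) · |c / t|⁻¹ = |t|⁻¹`. It is needed
for the involution used when `0 < x < 1`. -/
theorem measurePreserving_const_mul_inv (c : ℝˣ) :
    MeasurePreserving (fun u : ℝˣ => c * u⁻¹) realUnitsMeasure realUnitsMeasure := by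
  refine ⟨measurable_const_mul_inv c, Measure.ext fun A hA => ?_⟩
  rw [Measure.map_apply (measurable_const_mul_inv c) hA, realUnitsMeasure_apply hA,
    realUnitsMeasure_apply (measurable_const_mul_inv c hA)]
  set S := Units.val '' ((fun u : ℝˣ => c * u⁻¹) ⁻¹' A) with hS
  have himage : Units.val '' A = (fun t : ℝ => (c : ℝ) * t⁻¹) '' S := by
    ext r
    simp only [hS, Set.mem_image, Set.mem_preimage, exists_exists_and_eq_and]
    constructor
    · rintro ⟨u, hu, rfl⟩
      exact ⟨c * u⁻¹, by simpa using hu, by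
        have := c.ne_zero
        simp only [Units.val_mul, Units.val_inv_eq_inv_val]
        field_simp⟩
    · rintro ⟨u, hu, rfl⟩
      exact ⟨_, hu, by simp⟩
  have hne : ∀ t ∈ S, t ≠ 0 := by
    rintro _ ⟨u, -, rfl⟩
    exact u.ne_zero
  rw [himage, lintegral_image_eq_lintegral_abs_deriv_mul
    (f' := fun t => (c : ℝ) * (-(t ^ 2)⁻¹))
    (measurableEmbedding_unitsVal.measurableSet_image.mpr (measurable_const_mul_inv c hA))
    (fun t ht => ((hasDerivAt_inv (hne t ht)).const_mul _).hasDerivWithinAt)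
    (fun t _ t' _ h => inv_injective (mul_left_cancel₀ c.ne_zero h))]
  refine setLIntegral_congr_fun
    (measurableEmbedding_unitsVal.measurableSet_image.mpr (measurable_const_mul_inv c hA))
    fun t ht => ?_
  have h1 := hne t ht
  have h2 := c.ne_zero
  rw [← ENNReal.ofReal_mul (abs_nonneg _)]
  congr 1
  rw [abs_mul, abs_mul, abs_neg, abs_inv, abs_inv, abs_pow]
  have h3 : |t| ≠ 0 := abs_ne_zero.mpr h1
  have h4 : |(c : ℝ)| ≠ 0 := abs_ne_zero.mpr h2
  field_simp

/-! ### Decay and sign symmetry of the archimedean orbital function -/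

/-- The weight function `|u| / (1 + u²)` on `ℝ^*`. -/
def decay (u : ℝˣ) : ℝ := |(u : ℝ)| / (1 + (u : ℝ) ^ 2)

theorem decay_nonneg (u : ℝˣ) : 0 ≤ decay u := by
  rw [decay]
  positivity

theorem decay_le_one (u : ℝˣ) : decay u ≤ 1 := by
  rw [decay, div_le_one (by positivity)]
  nlinarith [sq_abs (u : ℝ), sq_nonneg (|(u : ℝ)| - 1), abs_nonneg (u : ℝ)]

/-- One of two factors `decay u` pays for `|u|^s` with `|Re s| ≤ 1`; the other remains to ensure
integrability. -/
theorem decay_sq_mul (u : ℝˣ) : decay u ^ 2 * (|(u : ℝ)| + |(u : ℝ)|⁻¹) = decay u := by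
  have h : |(u : ℝ)| ≠ 0 := abs_ne_zero.mpr u.ne_zero
  rw [decay, ← sq_abs (u : ℝ)]
  field_simp
  ring

theorem integrable_decay : Integrable decay realUnitsMeasure := by
  have hmeas : Measurable fun x : ℝ => ENNReal.ofReal |x|⁻¹ := by fun_prop
  have h : Integrable (fun x : ℝ => |x| / (1 + x ^ 2)) (realUnitsMeasure.map Units.val) := by
    rw [realUnitsMeasure, measurableEmbedding_unitsVal.map_comap]
    refine Integrable.restrict ?_
    rw [integrable_withDensity_iff hmeas (Eventually.of_forall fun _ => ENNReal.ofReal_lt_top)]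
    refine integrable_inv_one_add_sq.mono' (by fun_prop) (Eventually.of_forall fun x => ?_)
    rw [ENNReal.toReal_ofReal (by positivity), Real.norm_of_nonneg (by positivity)]
    by_cases hx : x = 0
    · simp [hx]
    · have : |x| ≠ 0 := abs_ne_zero.mpr hx
      field_simp
      exact le_rfl
  exact (measurableEmbedding_unitsVal.integrable_map_iff).mp h

/-- The archimedean test function at `t_a⁻¹ ξ(x) t_b`. -/
def archOrbit (k : ℕ) (d : ℝ) (x : RegularParam) (ab : ℝˣ × ℝˣ) : ℂ :=
  archTest k d ((torus ab.1)⁻¹ * GeneralLinearGroup.map (Rat.castHom ℝ) (xi x) * torus ab.2)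

theorem archOrbit_eq (k : ℕ) (d : ℝ) (x : RegularParam) (a b : ℝˣ) :
    archOrbit k d x (a, b) = if 0 < (a : ℝ)⁻¹ * b * (1 - (x : ℚ)) then
      (d : ℂ) * ((2 * √((a : ℝ)⁻¹ * b * (1 - (x : ℚ))) : ℝ) : ℂ) ^ k /
        ((((a : ℝ)⁻¹ * b + 1 : ℝ) : ℂ) + Complex.I * (((a : ℝ)⁻¹ * (x : ℚ) - b : ℝ) : ℂ)) ^ k
      else 0 := by
  have hdet : (a : ℝ)⁻¹ * b * 1 - (a : ℝ)⁻¹ * ((x : ℚ) : ℝ) * b =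
      (a : ℝ)⁻¹ * b * (1 - (x : ℚ)) := by ring
  rw [archOrbit, archTest, coe_orbit, Matrix.det_fin_two_of, hdet]
  rfl

theorem measurable_archOrbit (k : ℕ) (d : ℝ) (x : RegularParam) :
    Measurable (archOrbit k d x) := by
  have ha : Measurable fun ab : ℝˣ × ℝˣ => (ab.1 : ℝ) := measurable_unitsVal.comp measurable_fst
  have hb : Measurable fun ab : ℝˣ × ℝˣ => (ab.2 : ℝ) := measurable_unitsVal.comp measurable_snd
  have h : archOrbit k d x = fun ab => if 0 < (ab.1 : ℝ)⁻¹ * ab.2 * (1 - (x : ℚ)) then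
      (d : ℂ) * ((2 * √((ab.1 : ℝ)⁻¹ * ab.2 * (1 - (x : ℚ))) : ℝ) : ℂ) ^ k /
        ((((ab.1 : ℝ)⁻¹ * ab.2 + 1 : ℝ) : ℂ) +
          Complex.I * (((ab.1 : ℝ)⁻¹ * (x : ℚ) - ab.2 : ℝ) : ℂ)) ^ k
      else 0 := funext fun ab => archOrbit_eq k d x ab.1 ab.2
  rw [h]
  refine Measurable.ite (measurableSet_lt measurable_const (by fun_prop)) ?_ measurable_const
  fun_prop

/-- Expanding the denominator gives `1 + b² + b²/a² + x²/a²` plus the cross term `2 (b/a)(1 - x)`,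
which is twice the determinant and so positive. The rest is at least `min 1 x² · (1 + a⁻²)(1 + b²)`,
which separates the variables. -/
theorem det_div_normSq_le {x a b : ℝ} (hx : x ≠ 0) (ha : a ≠ 0) (hpos : 0 < a⁻¹ * b * (1 - x)) :
    4 * (a⁻¹ * b * (1 - x)) / ((a⁻¹ * b + 1) ^ 2 + (a⁻¹ * x - b) ^ 2) ≤
      4 * |1 - x| / min 1 (x ^ 2) * ((|a| / (1 + a ^ 2)) * (|b| / (1 + b ^ 2))) := by
  set c := min 1 (x ^ 2) with hc
  have hc0 : 0 < c := lt_min one_pos (by positivity)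
  have hc1 : c ≤ 1 := min_le_left _ _
  have hc2 : c ≤ x ^ 2 := min_le_right _ _
  have h1 : c * ((1 + a⁻¹ ^ 2) * (1 + b ^ 2)) ≤ (a⁻¹ * b + 1) ^ 2 + (a⁻¹ * x - b) ^ 2 := by
    have e1 : c * a⁻¹ ^ 2 ≤ x ^ 2 * a⁻¹ ^ 2 := mul_le_mul_of_nonneg_right hc2 (sq_nonneg _)
    have e2 : c * (1 + b ^ 2 + (a⁻¹ * b) ^ 2) ≤ 1 * (1 + b ^ 2 + (a⁻¹ * b) ^ 2) :=
      mul_le_mul_of_nonneg_right hc1 (by positivity)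
    nlinarith
  have h2 : a⁻¹ * b * (1 - x) = |a|⁻¹ * |b| * |1 - x| := by
    rw [← abs_of_pos hpos, abs_mul, abs_mul, abs_inv]
  have h3 : (0 : ℝ) < |a| := abs_pos.mpr ha
  calc 4 * (a⁻¹ * b * (1 - x)) / ((a⁻¹ * b + 1) ^ 2 + (a⁻¹ * x - b) ^ 2)
      ≤ 4 * (a⁻¹ * b * (1 - x)) / (c * ((1 + a⁻¹ ^ 2) * (1 + b ^ 2))) :=
        div_le_div_of_nonneg_left (by linarith) (by positivity) h1
    _ = _ := by
      rw [h2, ← sq_abs a, ← sq_abs a⁻¹, abs_inv]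
      field_simp
      ring

/-- Domination of the archimedean test function by a product. -/
theorem exists_norm_archOrbit_le {k : ℕ} (hk : 2 < k) (hkeven : Even k) (d : ℝ) (x : RegularParam) :
    ∃ C, 0 ≤ C ∧ ∀ ab, ‖archOrbit k d x ab‖ ≤ C * (decay ab.1 ^ 2 * decay ab.2 ^ 2) := by
  obtain ⟨m, rfl⟩ := hkeven
  have hm : 2 ≤ m := by omega
  have hx : (((x : ℚ) : ℝ)) ≠ 0 := by exact_mod_cast x.2.1
  set K : ℝ := 4 * |1 - ((x : ℚ) : ℝ)| / min 1 (((x : ℚ) : ℝ) ^ 2)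
  have hK : 0 ≤ K := by positivity
  refine ⟨|d| * K ^ m, by positivity, ?_⟩
  rintro ⟨a, b⟩
  have hmain : 0 ≤ |d| * K ^ m * (decay a ^ 2 * decay b ^ 2) := by positivity
  rw [archOrbit_eq]
  split_ifs with hpos
  · have h1 := det_div_normSq_le hx a.ne_zero hpos
    set Δ : ℝ := (a : ℝ)⁻¹ * b * (1 - (x : ℚ)) with hΔ
    have hnum : ‖((2 * √Δ : ℝ) : ℂ)‖ ^ (m + m) = (4 * Δ) ^ m := by
      rw [Complex.norm_real, Real.norm_of_nonneg (by positivity), ← two_mul, pow_mul, mul_pow,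
        Real.sq_sqrt hpos.le]
      norm_num
    have hden (u v : ℝ) : ‖(u : ℂ) + Complex.I * (v : ℂ)‖ ^ (m + m) = (u ^ 2 + v ^ 2) ^ m := by
      rw [← two_mul, pow_mul, Complex.sq_norm, mul_comm Complex.I, Complex.normSq_add_mul_I]
    rw [norm_div, norm_mul, norm_pow, norm_pow, hnum, hden, Complex.norm_real, Real.norm_eq_abs,
      mul_div_assoc, ← div_pow, mul_assoc]
    refine mul_le_mul_of_nonneg_left ?_ (abs_nonneg d)
    calc (4 * Δ / (((a : ℝ)⁻¹ * b + 1) ^ 2 + ((a : ℝ)⁻¹ * (x : ℚ) - b) ^ 2)) ^ m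
        ≤ (K * (decay a * decay b)) ^ m := pow_le_pow_left₀ (by positivity) h1 m
      _ = K ^ m * (decay a * decay b) ^ m := mul_pow _ _ _
      -- Since `k = 2m` is even and greater than `2`, `m ≥ 2`, and surplus powers of a quantity at
      -- most `1` can be dropped.
      _ ≤ K ^ m * (decay a * decay b) ^ 2 := by
        refine mul_le_mul_of_nonneg_left ?_ (by positivity)
        exact pow_le_pow_of_le_one (mul_nonneg (decay_nonneg a) (decay_nonneg b))
          (mul_le_one₀ (decay_le_one a) (decay_nonneg b) (decay_le_one b)) hm
      _ = _ := by rw [mul_pow]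
  · simpa using hmain

/-- For `x > 0` the archimedean orbital integral against the sign character vanishes. -/
theorem integral_archOrbit_eq_zero {k : ℕ} (hkeven : Even k) (d : ℝ) {x : RegularParam}
    (hx : 0 < (x : ℚ)) :
    ∫ ab, archOrbit k d x ab * (((ab.1 : ℝ) / |(ab.1 : ℝ)| : ℝ) : ℂ)
      ∂(realUnitsMeasure.prod realUnitsMeasure) = 0 := by
  set G : ℝˣ × ℝˣ → ℂ := fun ab =>
    archOrbit k d x ab * (((ab.1 : ℝ) / |(ab.1 : ℝ)| : ℝ) : ℂ) with hG
  have hGm : Measurable G := (measurable_archOrbit k d x).mul (by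
    have : Measurable fun ab : ℝˣ × ℝˣ => (ab.1 : ℝ) := measurable_unitsVal.comp measurable_fst
    fun_prop)
  -- A measure-preserving map that negates the integrand forces the integral to equal its own
  -- negative.
  suffices h : ∃ ψ : ℝˣ × ℝˣ → ℝˣ × ℝˣ, MeasurePreserving ψ
      (realUnitsMeasure.prod realUnitsMeasure) (realUnitsMeasure.prod realUnitsMeasure) ∧
      ∀ ab, G (ψ ab) = -G ab by
    obtain ⟨ψ, hψ, hanti⟩ := h
    have h1 : ∫ ab, G ab ∂(realUnitsMeasure.prod realUnitsMeasure) =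
        -∫ ab, G ab ∂(realUnitsMeasure.prod realUnitsMeasure) := by
      conv_lhs => rw [← hψ.map_eq]
      rw [integral_map hψ.measurable.aemeasurable hGm.aestronglyMeasurable]
      simp only [hanti]
      exact integral_neg _
    exact CharZero.eq_neg_self_iff.mp h1
  have hx0 : (0 : ℝ) < ((x : ℚ) : ℝ) := by exact_mod_cast hx
  have hxne : (((x : ℚ) : ℝ)) ≠ 1 := by exact_mod_cast x.2.2
  have hswap : MeasurePreserving (Prod.swap : ℝˣ × ℝˣ → ℝˣ × ℝˣ)
      (realUnitsMeasure.prod realUnitsMeasure) (realUnitsMeasure.prod realUnitsMeasure) :=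
    Measure.measurePreserving_swap
  have hsign (u v : ℝ) (h : u * v < 0) : v / |v| = -(u / |u|) := by
    rcases mul_neg_iff.mp h with ⟨h1, h2⟩ | ⟨h1, h2⟩
    · rw [abs_of_pos h1, abs_of_neg h2, div_self h1.ne', div_neg, div_self h2.ne]
    · rw [abs_of_neg h1, abs_of_pos h2, div_self h2.ne', div_neg, div_self h1.ne, neg_neg]
  rcases lt_or_gt_of_ne hxne with h1 | h1
  -- For `0 < x < 1` use `(a, b) ↦ (-x/b, -x/a)`. It fixes both `b/a` and `x/a - b`, hence
  -- `archOrbit`; on the support `ab > 0`, so `-x/b` and `a` have opposite signs.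
  · let c : ℝˣ := Units.mk0 (-((x : ℚ) : ℝ)) (neg_ne_zero.mpr hx0.ne')
    refine ⟨_, ((measurePreserving_const_mul_inv c).prod
      (measurePreserving_const_mul_inv c)).comp hswap, ?_⟩
    rintro ⟨a, b⟩
    have ha := a.ne_zero
    have hb := b.ne_zero
    have e1 : (((c * b⁻¹ : ℝˣ) : ℝ))⁻¹ * ((c * a⁻¹ : ℝˣ) : ℝ) = (a : ℝ)⁻¹ * b := by
      simp only [Units.val_mul, Units.val_inv_eq_inv_val, c, Units.val_mk0]
      field_simp
    have e2 : (((c * b⁻¹ : ℝˣ) : ℝ))⁻¹ * ((x : ℚ) : ℝ) - ((c * a⁻¹ : ℝˣ) : ℝ) =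
        (a : ℝ)⁻¹ * ((x : ℚ) : ℝ) - b := by
      simp only [Units.val_mul, Units.val_inv_eq_inv_val, c, Units.val_mk0]
      field_simp
      ring
    change archOrbit k d x (c * b⁻¹, c * a⁻¹) *
      (((((c * b⁻¹ : ℝˣ) : ℝ)) / |((c * b⁻¹ : ℝˣ) : ℝ)| : ℝ) : ℂ) =
      -(archOrbit k d x (a, b) * (((a : ℝ) / |(a : ℝ)| : ℝ) : ℂ))
    rw [archOrbit_eq, archOrbit_eq, e1, e2]
    split_ifs with hpos
    · have hab : 0 < (a : ℝ) * b := by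
        have : 0 < (a : ℝ)⁻¹ * b := pos_of_mul_pos_left hpos (by linarith)
        have h2 := mul_pos (mul_self_pos.mpr ha) this
        have h3 : (a : ℝ) * a * ((a : ℝ)⁻¹ * b) = a * b := by field_simp
        linarith
      have : (a : ℝ) * ((c * b⁻¹ : ℝˣ) : ℝ) < 0 := by
        simp only [Units.val_mul, Units.val_inv_eq_inv_val, c, Units.val_mk0]
        have h3 : (a : ℝ) * (-((x : ℚ) : ℝ) * (b : ℝ)⁻¹) = -(((x : ℚ) : ℝ) * (a * b) / b ^ 2) := by
          field_simp
        rw [h3]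
        have : 0 < ((x : ℚ) : ℝ) * (a * b) / (b : ℝ) ^ 2 := by positivity
        linarith
      rw [hsign _ _ this]
      push_cast
      ring
    · simp
  -- For `x > 1` the support has `ab < 0`, so exchanging `a` and `b` reverses the sign. The
  -- denominator base scales by `a/b` and the square root by `|a/b|`; for even `k` the two powers
  -- cancel.
  · refine ⟨_, hswap, ?_⟩
    rintro ⟨a, b⟩
    have ha := a.ne_zero
    have hb := b.ne_zero
    change archOrbit k d x (b, a) * (((b : ℝ) / |(b : ℝ)| : ℝ) : ℂ) =
      -(archOrbit k d x (a, b) * (((a : ℝ) / |(a : ℝ)| : ℝ) : ℂ))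
    rw [archOrbit_eq, archOrbit_eq]
    have hiff : 0 < (b : ℝ)⁻¹ * a * (1 - (x : ℚ)) ↔ 0 < (a : ℝ)⁻¹ * b * (1 - (x : ℚ)) := by
      have e1 : (b : ℝ)⁻¹ * a * (1 - (x : ℚ)) = ((a : ℝ) / b) ^ 2 * ((a : ℝ)⁻¹ * b * (1 - (x : ℚ))) := by
        field_simp
      rw [e1]
      exact mul_pos_iff_of_pos_left (by positivity)
    by_cases hpos : 0 < (a : ℝ)⁻¹ * b * (1 - (x : ℚ))
    · rw [if_pos hpos, if_pos (hiff.mpr hpos)]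
      have hab : (a : ℝ) * b < 0 := by
        have : (a : ℝ)⁻¹ * b < 0 := by
          by_contra h
          nlinarith [mul_nonneg (not_lt.mp h) (by linarith : 0 ≤ ((x : ℚ) : ℝ) - 1)]
        have h2 := mul_neg_of_pos_of_neg (mul_self_pos.mpr ha) this
        have h3 : (a : ℝ) * a * ((a : ℝ)⁻¹ * b) = a * b := by field_simp
        linarith
      rw [hsign _ _ hab]
      obtain ⟨m, rfl⟩ := hkeven
      have hΔ : (b : ℝ)⁻¹ * a * (1 - (x : ℚ)) =
          ((a : ℝ) / b) ^ 2 * ((a : ℝ)⁻¹ * b * (1 - (x : ℚ))) := by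
        field_simp
      have haC : ((a : ℝ) : ℂ) ≠ 0 := by exact_mod_cast ha
      have hbC : ((b : ℝ) : ℂ) ≠ 0 := by exact_mod_cast hb
      have hD : (((b : ℝ)⁻¹ * a + 1 : ℝ) : ℂ) +
          Complex.I * (((b : ℝ)⁻¹ * (x : ℚ) - a : ℝ) : ℂ) = ((a : ℝ) : ℂ) / ((b : ℝ) : ℂ) *
          ((((a : ℝ)⁻¹ * b + 1 : ℝ) : ℂ) + Complex.I * (((a : ℝ)⁻¹ * (x : ℚ) - b : ℝ) : ℂ)) := by
        push_cast
        field_simp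
        ring
      have hnum : (((2 * √((b : ℝ)⁻¹ * a * (1 - (x : ℚ))) : ℝ) : ℂ)) ^ (m + m) =
          (((a : ℝ) : ℂ) / ((b : ℝ) : ℂ)) ^ (m + m) *
            ((2 * √((a : ℝ)⁻¹ * b * (1 - (x : ℚ))) : ℝ) : ℂ) ^ (m + m) := by
        rw [hΔ, Real.sqrt_mul (sq_nonneg _), Real.sqrt_sq_eq_abs]
        rw [← Complex.ofReal_div, ← Complex.ofReal_pow, ← Complex.ofReal_pow, ← Complex.ofReal_pow,
          ← Complex.ofReal_mul, Complex.ofReal_inj]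
        rw [show 2 * (|(a : ℝ) / b| * √((a : ℝ)⁻¹ * b * (1 - (x : ℚ)))) =
          |(a : ℝ) / b| * (2 * √((a : ℝ)⁻¹ * b * (1 - (x : ℚ)))) by ring, mul_pow,
          Even.pow_abs ⟨m, rfl⟩]
      rw [hD, hnum, mul_pow]
      have hne : (((a : ℝ) : ℂ) / ((b : ℝ) : ℂ)) ^ (m + m) ≠ 0 := pow_ne_zero _ (div_ne_zero haC hbC)
      rw [mul_left_comm, mul_div_mul_left _ _ hne]
      push_cast
      ring
    · rw [if_neg hpos, if_neg (fun h => hpos (hiff.mp h))]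
      simp

/-! ### The finite part of the orbital integrand -/

theorem finite_setOf_norm_rat_ne_one {r : ℚ} (hr : r ≠ 0) :
    {q : Nat.Primes | ‖(r : ℚ_[q])‖ ≠ 1}.Finite := by
  have h : ∀ᶠ q : Nat.Primes in cofinite, ‖(r : ℚ_[q])‖ = 1 := by
    filter_upwards [eventually_norm_rat_le_one r, eventually_norm_rat_le_one r⁻¹] with q h1 h2
    have h3 : 0 < ‖(r : ℚ_[q])‖ := norm_pos_iff.mpr (by exact_mod_cast hr)
    rw [Rat.cast_inv, norm_inv] at h2
    exact le_antisymm h1 ((inv_le_one₀ h3).mp h2)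
  exact Filter.eventually_cofinite.mp h

theorem exists_int_of_forall_norm_le_one {z : ℚ} (h : ∀ q : Nat.Primes, ‖(z : ℚ_[q])‖ ≤ 1) :
    ∃ n : ℤ, (n : ℚ) = z := by
  refine ⟨z.num, Rat.coe_int_num_of_den_eq_one ?_⟩
  by_contra hden
  obtain ⟨q, hq, hdvd⟩ := Nat.exists_prime_and_dvd hden
  have : Fact q.Prime := ⟨hq⟩
  have h1 : ‖(z : ℚ_[q])‖ ≤ 1 := h ⟨q, hq⟩
  have h2 : ‖((z.den : ℤ) : ℚ_[q])‖ < 1 :=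
    Padic.norm_intCast_lt_one_iff |>.mpr (by exact_mod_cast hdvd)
  have h3 : ‖((z.num : ℤ) : ℚ_[q])‖ < 1 := by
    have h4 : ((z.num : ℤ) : ℚ_[q]) = (z : ℚ_[q]) * ((z.den : ℤ) : ℚ_[q]) := by
      have := Rat.mul_den_eq_num z
      exact_mod_cast (congrArg (fun r : ℚ => (r : ℚ_[q])) this).symm
    rw [h4, norm_mul]
    exact mul_lt_one_of_nonneg_of_lt_one_right h1 (norm_nonneg _) h2
  have h5 : (q : ℤ) ∣ z.num := Padic.norm_intCast_lt_one_iff |>.mp h3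
  have h6 := Nat.dvd_gcd (Int.natCast_dvd.mp h5) hdvd
  rw [z.reduced.gcd_eq_one] at h6
  exact hq.one_lt.ne' (Nat.dvd_one.mp h6)

section FinitePart

variable {χ : Ideles →* ℂˣ} {p : Nat.Primes} {fp : GL (Fin 2) ℚ_[p] → ℂ}

theorem localTest_self (N : Nat.Primes) : localTest χ p fp N p = fp := by
  simp [localTest]

theorem localTest_level {N : Nat.Primes} (hN : N ≠ p) : localTest χ p fp N N = levelTest N := by
  simp [localTest, hN]

theorem localTest_unramified {N q : Nat.Primes} (hp : q ≠ p) (hN : q ≠ N)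
    (hq : ¬ IsRamifiedAt χ q) : localTest χ p fp N q = unramifiedTest q := by
  simp [localTest, hp, hN, hq]

theorem localTest_ramified {N q : Nat.Primes} (hp : q ≠ p) (hN : q ≠ N)
    (hq : IsRamifiedAt χ q) : localTest χ p fp N q = ramifiedTest χ q := by
  simp [localTest, hp, hN, hq]

/-- The supports of the local test functions are bounded modulo the centre, uniformly in `N`. -/
theorem exists_uniform_isLocalTest (hχ : {q | IsRamifiedAt χ q}.Finite)
    (hfp : fp ∈ heckeAlgebra p) :
    ∃ M : Nat.Primes → ℝ, {q | M q ≠ 1}.Finite ∧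
      ∀ N, N ≠ p → ∀ q, IsLocalTest (localTest χ p fp N q) (M q) := by
  classical
  obtain ⟨Mp, hMp⟩ := exists_isLocalTest_of_mem_heckeAlgebra hfp
  choose Mr hMr using exists_isLocalTest_ramifiedTest χ
  -- The bound at `q` must not depend on whether `q = N`. The level function has bound `1`, so `max
  -- 1` also covers a ramified `q` equal to `N`.
  refine ⟨fun q => if q = p then max 1 (if h : q = p then Mp else 1) else
    if IsRamifiedAt χ q then max 1 (Mr q) else 1, ?_, fun N hN q => ?_⟩
  · refine (hχ.union (Set.finite_singleton p)).subset fun q hq => ?_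
    by_contra h
    simp only [Set.mem_union, Set.mem_singleton_iff, not_or] at h
    exact hq (by simp [h.2, show ¬ IsRamifiedAt χ q from h.1])
  · by_cases hqp : q = p
    · subst hqp
      rw [localTest_self]
      simpa using hMp.mono (le_max_right _ _)
    · simp only [hqp, if_false]
      by_cases hqN : q = N
      · subst hqN
        rw [localTest_level hN]
        refine isLocalTest_levelTest.mono ?_
        split_ifs
        exacts [le_max_left _ _, le_rfl]
      · by_cases hq : IsRamifiedAt χ q
        · rw [localTest_ramified hqp hqN hq, if_pos hq]
          exact (hMr q).mono (le_max_right _ _)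
        · rw [localTest_unramified hqp hqN hq, if_neg hq]
          exact isLocalTest_unramifiedTest

variable (χ p fp) in
/-- The finite part of the test function at `t_a⁻¹ ξ(x) t_b`. -/
def finiteOrbit (N : Nat.Primes) (x : RegularParam) (ab : FiniteIdeles × FiniteIdeles) : ℂ :=
  ∏ᶠ q : Nat.Primes, localTest χ p fp N q (orbitMatrix x (ab.1 q) (ab.2 q))

/-- Outside a finite set of primes the test function is the unramified one and `x`, `1 - x` are
units. -/
theorem exists_exceptional_primes (hχ : {q | IsRamifiedAt χ q}.Finite) (N : Nat.Primes)
    (x : RegularParam) : ∃ T : Finset Nat.Primes, ∀ q ∉ T,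
      localTest χ p fp N q = unramifiedTest q ∧ ‖((x : ℚ) : ℚ_[q])‖ = 1 ∧
        ‖1 - ((x : ℚ) : ℚ_[q])‖ = 1 := by
  have h1 := finite_setOf_norm_rat_ne_one x.2.1
  have h2 := finite_setOf_norm_rat_ne_one (sub_ne_zero.mpr (Ne.symm x.2.2))
  have hfin := (hχ.union (Set.toFinite {p, N})).union (h1.union h2)
  refine ⟨hfin.toFinset, fun q hq => ?_⟩
  simp only [Set.Finite.mem_toFinset, Set.mem_union, Set.mem_insert_iff, Set.mem_singleton_iff,
    not_or, Set.mem_ofPred_eq, not_not] at hq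
  obtain ⟨⟨h3, h4, h5⟩, h6, h7⟩ := hq
  exact ⟨localTest_unramified h4 h5 h3, h6, by simpa using h7⟩

theorem finite_mulSupport_localTest (hχ : {q | IsRamifiedAt χ q}.Finite) (N : Nat.Primes)
    (x : RegularParam) (ab : FiniteIdeles × FiniteIdeles) :
    (Function.mulSupport fun q : Nat.Primes =>
      localTest χ p fp N q (orbitMatrix x (ab.1 q) (ab.2 q))).Finite := by
  obtain ⟨T, hT⟩ := exists_exceptional_primes (p := p) (fp := fp) hχ N x
  have h : ∀ᶠ q in cofinite, q ∉ (Function.mulSupport fun q : Nat.Primes =>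
      localTest χ p fp N q (orbitMatrix x (ab.1 q) (ab.2 q))) := by
    filter_upwards [ab.1.eventually, ab.2.eventually, T.finite_toSet.compl_mem_cofinite]
      with q h1 h2 h3
    obtain ⟨h4, h5, h6⟩ := hT q h3
    rw [Function.notMem_mulSupport, h4]
    exact unramifiedTest_orbitMatrix h5 h6 h1 h2
  exact (Filter.eventually_cofinite.mp h).subset fun q hq hn => hn hq

theorem localTest_ne_zero_of_finiteOrbit_ne_zero (hχ : {q | IsRamifiedAt χ q}.Finite)
    {N : Nat.Primes} {x : RegularParam} {ab : FiniteIdeles × FiniteIdeles}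
    (h : finiteOrbit χ p fp N x ab ≠ 0) (q : Nat.Primes) :
    localTest χ p fp N q (orbitMatrix x (ab.1 q) (ab.2 q)) ≠ 0 := fun h0 =>
  h (finprod_eq_zero _ q h0 (finite_mulSupport_localTest hχ N x ab))

-- A product over a fixed finite set replaces one whose support varies with the point; measurability
-- and boundedness become finite checks.
open Classical in
theorem finiteOrbit_eq (hχ : {q | IsRamifiedAt χ q}.Finite) {N : Nat.Primes} {x : RegularParam}
    {T : Finset Nat.Primes} (hT : ∀ q ∉ T, localTest χ p fp N q = unramifiedTest q ∧
      ‖((x : ℚ) : ℚ_[q])‖ = 1 ∧ ‖1 - ((x : ℚ) : ℚ_[q])‖ = 1)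
    (ab : FiniteIdeles × FiniteIdeles) :
    finiteOrbit χ p fp N x ab =
      if (∀ q, q ∉ T → ab.1 q ∈ padicUnits q) ∧ ∀ q, q ∉ T → ab.2 q ∈ padicUnits q then
        ∏ q ∈ T, localTest χ p fp N q (orbitMatrix x (ab.1 q) (ab.2 q))
      else 0 := by
  split_ifs with h
  · refine finprod_eq_prod_of_mulSupport_subset _ fun q hq => ?_
    by_contra hqT
    obtain ⟨h4, h5, h6⟩ := hT q hqT
    refine hq ?_
    simp only [h4]
    exact unramifiedTest_orbitMatrix h5 h6 (h.1 q hqT) (h.2 q hqT)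
  · by_contra hne
    refine h ⟨fun q hq => ?_, fun q hq => ?_⟩ <;>
    · have h1 := localTest_ne_zero_of_finiteOrbit_ne_zero hχ hne q
      obtain ⟨h4, h5, h6⟩ := hT q hq
      rw [h4] at h1
      have := mem_padicUnits_of_unramifiedTest_ne_zero h5 h6 h1
      first | exact this.1 | exact this.2

theorem measurable_finiteOrbit (hχ : {q | IsRamifiedAt χ q}.Finite) (hfp : fp ∈ heckeAlgebra p)
    {N : Nat.Primes} (hN : N ≠ p) (x : RegularParam) :
    Measurable (finiteOrbit χ p fp N x) := by
  classical
  obtain ⟨T, hT⟩ := exists_exceptional_primes (p := p) (fp := fp) hχ N x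
  obtain ⟨M, -, hM⟩ := exists_uniform_isLocalTest hχ hfp
  have hW : MeasurableSet {a : FiniteIdeles | ∀ q, q ∉ T → a q ∈ padicUnits q} :=
    (RestrictedProduct.isOpen_forall_imp_mem isOpen_padicUnits).measurableSet
  have hWW : MeasurableSet {ab : FiniteIdeles × FiniteIdeles |
      (∀ q, q ∉ T → ab.1 q ∈ padicUnits q) ∧ ∀ q, q ∉ T → ab.2 q ∈ padicUnits q} :=
    (measurable_fst hW).inter (measurable_snd hW)
  have hprod (q : Nat.Primes) : Continuous fun ab : FiniteIdeles × FiniteIdeles =>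
      localTest χ p fp N q (orbitMatrix x (ab.1 q) (ab.2 q)) := by
    have h1 : Continuous fun ab : FiniteIdeles × FiniteIdeles => ab.1 q :=
      (RestrictedProduct.continuous_eval q).comp continuous_fst
    have h2 : Continuous fun ab : FiniteIdeles × FiniteIdeles => ab.2 q :=
      (RestrictedProduct.continuous_eval q).comp continuous_snd
    have h3 : Continuous fun ab : FiniteIdeles × FiniteIdeles => orbitMatrix x (ab.1 q) (ab.2 q) :=
      continuous_orbitMatrix x h1 h2
    have h4 : Continuous (localTest χ p fp N q) := (hM N hN q).continuous
    exact h4.comp h3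
  have hmeas (q : Nat.Primes) := (hprod q).measurable
  have hcont : Measurable fun ab : FiniteIdeles × FiniteIdeles =>
      ∏ q ∈ T, localTest χ p fp N q (orbitMatrix x (ab.1 q) (ab.2 q)) :=
    Finset.measurable_fun_prod T fun q _ => hmeas q
  rw [funext fun ab => finiteOrbit_eq hχ hT ab]
  exact Measurable.ite hWW hcont measurable_const

theorem exists_bound_finiteOrbit (hχ : {q | IsRamifiedAt χ q}.Finite) (hfp : fp ∈ heckeAlgebra p)
    {N : Nat.Primes} (hN : N ≠ p) (x : RegularParam) :
    ∃ B : ℝ, ∃ K : Set FiniteIdeles, IsCompact K ∧ 0 ≤ B ∧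
      ∀ ab, ‖finiteOrbit χ p fp N x ab‖ ≤ B ∧
        (finiteOrbit χ p fp N x ab ≠ 0 → ab.1 ∈ K ∧ ab.2 ∈ K) := by
  classical
  obtain ⟨T, hT⟩ := exists_exceptional_primes (p := p) (fp := fp) hχ N x
  obtain ⟨M, -, hM⟩ := exists_uniform_isLocalTest hχ hfp
  choose B hB using fun q => (hM N hN q).bounded
  have hB0 (q) : 0 ≤ B q := (norm_nonneg _).trans (hB q 1)
  have hxpos (q : Nat.Primes) : 0 < ‖((x : ℚ) : ℚ_[q])‖ :=
    norm_pos_iff.mpr (by exact_mod_cast x.2.1)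
  let W : Nat.Primes → ℝ := fun q => M q * ‖1 - ((x : ℚ) : ℚ_[q])‖
  -- The second entry of the maximum turns the lower bound `‖x‖ ≤ W q * r` into `1 ≤ (W q / ‖x‖) *
  -- r`.
  obtain ⟨K, hK, hmem⟩ := exists_isCompact_of_bounded T fun q =>
    max (W q) (W q / ‖((x : ℚ) : ℚ_[q])‖)
  refine ⟨∏ q ∈ T, B q, K, hK, Finset.prod_nonneg fun q _ => hB0 q, fun ab => ⟨?_, fun hne => ?_⟩⟩
  · rw [finiteOrbit_eq hχ hT]
    split_ifs
    · rw [norm_prod]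
      exact Finset.prod_le_prod (fun _ _ => norm_nonneg _) fun q _ => hB q _
    · simpa using Finset.prod_nonneg fun q (_ : q ∈ T) => hB0 q
  · have hunits : (∀ q, q ∉ T → ab.1 q ∈ padicUnits q) ∧
        ∀ q, q ∉ T → ab.2 q ∈ padicUnits q := by
      by_contra h
      rw [finiteOrbit_eq hχ hT, if_neg h] at hne
      exact hne rfl
    have hb (q) := norm_le_of_boundedModCenter ((hM N hN q).support _
      (localTest_ne_zero_of_finiteOrbit_ne_zero hχ hne q))
    have key (q : Nat.Primes) {r : ℝ} (hr : 0 ≤ r) (h1 : ‖((x : ℚ) : ℚ_[q])‖ ≤ W q * r) :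
        1 ≤ max (W q) (W q / ‖((x : ℚ) : ℚ_[q])‖) * r := by
      refine le_trans ?_ (mul_le_mul_of_nonneg_right (le_max_right _ _) hr)
      rwa [div_mul_eq_mul_div, one_le_div (hxpos q)]
    exact ⟨hmem _ hunits.1 fun q _ => ⟨(hb q).1.1.trans (le_max_left _ _),
      key q (norm_nonneg _) (hb q).1.2⟩, hmem _ hunits.2 fun q _ =>
      ⟨(hb q).2.1.trans (le_max_left _ _), key q (norm_nonneg _) (hb q).2.2⟩⟩

/-! ### Integrality: finiteness in `x` and in `N` -/

/-- A common denominator for the `(1 - x)⁻¹` with nonzero finite part. -/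
theorem exists_denominator {M : Nat.Primes → ℝ} (hM : {q | M q ≠ 1}.Finite) :
    ∃ D : ℕ, 0 < D ∧ ∀ q : Nat.Primes, M q * ‖(D : ℚ_[q])‖ ≤ 1 := by
  have hn (q : Nat.Primes) : ∃ n : ℕ, M q < ((q : ℕ) : ℝ) ^ n :=
    pow_unbounded_of_one_lt _ (by exact_mod_cast q.2.one_lt)
  choose n hn using hn
  refine ⟨∏ q ∈ hM.toFinset, (q : ℕ) ^ n q,
    Finset.prod_pos fun q _ => pow_pos q.2.pos _, fun q => ?_⟩
  by_cases hq : q ∈ hM.toFinset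
  · have h1 := (Padic.norm_int_le_pow_iff_dvd (p := q)
      ((∏ q ∈ hM.toFinset, (q : ℕ) ^ n q : ℕ) : ℤ) (n q)).mpr (by
        exact_mod_cast Finset.dvd_prod_of_mem (fun q : Nat.Primes => (q : ℕ) ^ n q) hq)
    have hpos : (0 : ℝ) < ((q : ℕ) : ℝ) ^ n q := pow_pos (by exact_mod_cast q.2.pos) _
    rw [_root_.zpow_neg, zpow_natCast, Int.cast_natCast] at h1
    calc M q * ‖((∏ q ∈ hM.toFinset, (q : ℕ) ^ n q : ℕ) : ℚ_[q])‖
        ≤ ((q : ℕ) : ℝ) ^ n q * (((q : ℕ) : ℝ) ^ n q)⁻¹ :=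
          mul_le_mul (hn q).le h1 (norm_nonneg _) hpos.le
      _ = 1 := mul_inv_cancel₀ hpos.ne'
  · have h1 : M q = 1 := by simpa using hq
    rw [h1, one_mul]
    exact_mod_cast Padic.norm_int_le_one (p := q) ((∏ q ∈ hM.toFinset, (q : ℕ) ^ n q : ℕ) : ℤ)

/-- For negative `x` the finite part is nonzero only for finitely many `x`, and only if the level is
bounded. -/
theorem exists_bound_of_finiteOrbit_ne_zero (hχ : {q | IsRamifiedAt χ q}.Finite)
    (hfp : fp ∈ heckeAlgebra p) :
    ∃ D : ℕ, ∃ X : Set RegularParam, X.Finite ∧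
      ∀ N, N ≠ p → ∀ x : RegularParam, (x : ℚ) < 0 → ∀ ab, finiteOrbit χ p fp N x ab ≠ 0 →
        x ∈ X ∧ (N : ℕ) ≤ D := by
  obtain ⟨M, hMfin, hM⟩ := exists_uniform_isLocalTest hχ hfp
  obtain ⟨D, hD, hDM⟩ := exists_denominator hMfin
  refine ⟨D, Subtype.val ⁻¹' ((fun w : ℤ => 1 - (D : ℚ) / (w : ℚ)) '' Set.Ioo 0 (D : ℤ)),
    ((Set.finite_Ioo _ _).image _).preimage Subtype.val_injective.injOn,
    fun N hN x hx ab hne => ?_⟩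
  have hloc := localTest_ne_zero_of_finiteOrbit_ne_zero hχ hne
  have h1x : (0 : ℚ) < 1 - x := by linarith
  have hcast (q : Nat.Primes) : ((1 - (x : ℚ) : ℚ) : ℚ_[q]) = 1 - ((x : ℚ) : ℚ_[q]) := by push_cast; rfl
  have hpos (q : Nat.Primes) : 0 < ‖1 - ((x : ℚ) : ℚ_[q])‖ := by
    rw [← hcast, norm_pos_iff]
    exact_mod_cast h1x.ne'
  -- From `M q ‖D‖ ≤ 1 ≤ M q ‖1 - x‖` follows `‖D‖ ≤ ‖1 - x‖` at every prime. Since `1 - x > 1`, the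
  -- resulting integer lies strictly between `0` and `D`, and it determines `x`.
  obtain ⟨w, hw⟩ := exists_int_of_forall_norm_le_one (z := (D : ℚ) / (1 - x)) fun q => by
    have h1 := one_le_of_boundedModCenter ((hM N hN q).support _ (hloc q))
    have h2 := hDM q
    rw [Rat.cast_div, hcast, Rat.cast_natCast, norm_div, div_le_one (hpos q)]
    have h3 : 0 < M q := by
      by_contra h
      nlinarith [hpos q]
    nlinarith [hpos q]
  have hDQ : (0 : ℚ) < D := by exact_mod_cast hD
  have hw0 : (0 : ℚ) < w := by rw [hw]; positivity
  have hwD : (w : ℚ) < D := by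
    rw [hw, div_lt_iff₀ h1x]
    nlinarith
  have hw0' : 0 < w := by exact_mod_cast hw0
  have hwD' : w < D := by exact_mod_cast hwD
  refine ⟨⟨w, ⟨hw0', hwD'⟩, ?_⟩, ?_⟩
  · change 1 - (D : ℚ) / (w : ℚ) = x
    rw [hw]
    field_simp
    ring
  · have h1 := hloc N
    rw [localTest_level hN] at h1
    have h2 := norm_lt_of_orbitMatrix_mem_centerIwahori (Set.mem_of_indicator_ne_zero h1)
    -- The level condition makes this integer divisible by `N`; as it is positive and less than `D`,
    -- it bounds `N`.
    have h3 : ((D : ℚ) - w) = -(D : ℚ) * (x : ℚ) / (1 - x) := by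
      rw [hw]
      field_simp
      ring
    have h4 : ‖(((D : ℤ) - w : ℤ) : ℚ_[N])‖ < 1 := by
      have h5 : (((D : ℤ) - w : ℤ) : ℚ_[N]) =
          -(D : ℚ_[N]) * ((x : ℚ) : ℚ_[N]) / (1 - ((x : ℚ) : ℚ_[N])) := by
        have := congrArg (fun r : ℚ => (r : ℚ_[N])) h3
        push_cast at this ⊢
        exact this
      rw [h5, norm_div, norm_mul, norm_neg, div_lt_one (hpos N)]
      refine lt_of_le_of_lt ?_ h2
      refine mul_le_of_le_one_left (norm_nonneg _) ?_
      exact_mod_cast Padic.norm_int_le_one (p := N) (D : ℤ)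
    have h6 := Int.le_of_dvd (by omega) ((Padic.norm_intCast_lt_one_iff).mp h4)
    have : ((N : ℕ) : ℤ) ≤ D := by omega
    exact_mod_cast this

end FinitePart

/-! ### The global orbital integrals -/

instance instSFiniteIdeleMeasure : SFinite ideleMeasure := by
  rw [ideleMeasure]
  infer_instance

theorem measurable_finiteNorm : Measurable finiteNorm := continuous_finiteNorm.measurable

theorem measurable_ideleNorm : Measurable ideleNorm :=
  ((measurable_unitsVal.comp measurable_fst).norm).mul (measurable_finiteNorm.comp measurable_snd)

theorem measurableSet_truncation (c : ℝ) : MeasurableSet (truncation c) := by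
  have h1 : Measurable fun ab : Ideles × Ideles => ideleNorm ab.1 :=
    measurable_ideleNorm.comp measurable_fst
  have h2 : Measurable fun ab : Ideles × Ideles => ideleNorm ab.2 :=
    measurable_ideleNorm.comp measurable_snd
  exact (measurableSet_lt measurable_const h1).inter ((measurableSet_lt h1 measurable_const).inter
    ((measurableSet_lt measurable_const h2).inter (measurableSet_lt h2 measurable_const)))

/-- The truncated domains exhaust `𝔸^* × 𝔸^*`. -/
theorem aecover_truncation (μ : Measure (Ideles × Ideles)) : AECover μ atTop truncation where
  measurableSet := measurableSet_truncation
  ae_eventually_mem := Eventually.of_forall fun ab => by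
    filter_upwards [eventually_gt_atTop (ideleNorm ab.1), eventually_gt_atTop (ideleNorm ab.2),
      eventually_gt_atTop (ideleNorm ab.1)⁻¹, eventually_gt_atTop (ideleNorm ab.2)⁻¹]
      with c h1 h2 h3 h4
    exact ⟨inv_lt_of_inv_lt₀ (ideleNorm_pos _) h3, h1, inv_lt_of_inv_lt₀ (ideleNorm_pos _) h4, h2⟩

/-- Removes the dependence on the exponent, so that a single majorant serves all small `s`. -/
theorem rpow_le_add_inv {r t : ℝ} (hr : 0 < r) (ht : |t| ≤ 1) : r ^ t ≤ r + r⁻¹ := by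
  obtain ⟨h1, h2⟩ := abs_le.mp ht
  rcases le_total 1 r with h | h
  · have := Real.rpow_le_rpow_of_exponent_le h h2
    rw [Real.rpow_one] at this
    have : 0 < r⁻¹ := inv_pos.mpr hr
    linarith
  · have := Real.rpow_le_rpow_of_exponent_ge hr h h1
    rw [Real.rpow_neg_one] at this
    linarith

theorem norm_ideleNorm_cpow_le (a : Ideles) {s : ℂ} (hs : |s.re| ≤ 1) :
    ‖(ideleNorm a : ℂ) ^ s‖ ≤
      (|(a.1 : ℝ)| + |(a.1 : ℝ)|⁻¹) * (finiteNorm a.2 + (finiteNorm a.2)⁻¹) := by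
  have h1 : 0 < |(a.1 : ℝ)| := abs_pos.mpr a.1.ne_zero
  rw [Complex.norm_cpow_eq_rpow_re_of_pos (ideleNorm_pos a), ideleNorm_eq,
    Real.mul_rpow h1.le (finiteNorm_pos _).le]
  have h2 := finiteNorm_pos a.2
  exact mul_le_mul (rpow_le_add_inv h1 hs) (rpow_le_add_inv h2 hs) (by positivity) (by positivity)

section Global

variable {k : ℕ} {d : ℝ} {χ : Ideles →* ℂˣ} {p : Nat.Primes} {fp : GL (Fin 2) ℚ_[p] → ℂ}

theorem orbitalIntegrand_eq (N : Nat.Primes) (x : RegularParam) (s : ℂ × ℂ) (ab : Ideles × Ideles) :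
    orbitalIntegrand k d χ p fp N x s ab =
      archOrbit k d x (ab.1.1, ab.2.1) * finiteOrbit χ p fp N x (ab.1.2, ab.2.2) * (χ ab.1 : ℂ) *
        (ideleNorm ab.1 : ℂ) ^ s.1 * (ideleNorm ab.2 : ℂ) ^ s.2 := rfl

theorem measurable_apply (hχcont : Continuous χ) (hquad : ∀ a, χ a ^ 2 = 1)
    (hodd : realChar χ (-1) = -1) : Measurable fun a : Ideles => (χ a : ℂ) := by
  have h1 : Measurable fun a : Ideles => (a.1 : ℝ) := measurable_unitsVal.comp measurable_fst
  have h2 : Continuous fun a : FiniteIdeles => (χ (1, a) : ℂ) :=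
    Units.continuous_val.comp (hχcont.comp (continuous_const.prodMk continuous_id))
  have h3 : Measurable fun a : Ideles => (χ (1, a.2) : ℂ) := h2.measurable.comp measurable_snd
  have h4 : (fun a : Ideles => (χ a : ℂ)) =
      fun a : Ideles => (((a.1 : ℝ) / |(a.1 : ℝ)| : ℝ) : ℂ) * (χ (1, a.2) : ℂ) := by
    ext a
    rw [apply_eq_realChar_mul, realChar_eq hquad hodd]
  rw [h4]
  exact (by fun_prop : Measurable fun a : Ideles => (((a.1 : ℝ) / |(a.1 : ℝ)| : ℝ) : ℂ)).mul h3

theorem measurable_orbitalIntegrand (hχcont : Continuous χ) (hquad : ∀ a, χ a ^ 2 = 1)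
    (hodd : realChar χ (-1) = -1) (hfp : fp ∈ heckeAlgebra p) {N : Nat.Primes} (hN : N ≠ p)
    (x : RegularParam) (s : ℂ × ℂ) : Measurable (orbitalIntegrand k d χ p fp N x s) := by
  have h1 : Measurable fun ab : Ideles × Ideles => archOrbit k d x (ab.1.1, ab.2.1) :=
    (measurable_archOrbit k d x).comp (by fun_prop)
  have h2 : Measurable fun ab : Ideles × Ideles => finiteOrbit χ p fp N x (ab.1.2, ab.2.2) :=
    (measurable_finiteOrbit (finite_setOf_isRamifiedAt hχcont hquad) hfp hN x).comp (by fun_prop)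
  have h3 : Measurable fun ab : Ideles × Ideles => (χ ab.1 : ℂ) :=
    (measurable_apply hχcont hquad hodd).comp measurable_fst
  have h4 : Measurable fun ab : Ideles × Ideles => (ideleNorm ab.1 : ℂ) ^ s.1 :=
    (Complex.measurable_ofReal.comp (measurable_ideleNorm.comp measurable_fst)).pow_const _
  have h5 : Measurable fun ab : Ideles × Ideles => (ideleNorm ab.2 : ℂ) ^ s.2 :=
    (Complex.measurable_ofReal.comp (measurable_ideleNorm.comp measurable_snd)).pow_const _
  exact (((h1.mul h2).mul h3).mul h4).mul h5

/-- The orbital integrand is dominated by an integrable function, uniformly for `s` near `0`. -/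
theorem exists_integrable_bound (hk : 2 < k) (hkeven : Even k) (hχcont : Continuous χ)
    (hquad : ∀ a, χ a ^ 2 = 1) (hfp : fp ∈ heckeAlgebra p) {N : Nat.Primes} (hN : N ≠ p)
    (x : RegularParam) :
    ∃ g : Ideles × Ideles → ℝ, Integrable g (ideleMeasure.prod ideleMeasure) ∧
      ∀ s : ℂ × ℂ, |s.1.re| ≤ 1 → |s.2.re| ≤ 1 → ∀ ab,
        ‖orbitalIntegrand k d χ p fp N x s ab‖ ≤ g ab := by
  obtain ⟨A, hA0, hA⟩ := exists_norm_archOrbit_le hk hkeven d x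
  obtain ⟨B, K, hK, hB0, hB⟩ :=
    exists_bound_finiteOrbit (finite_setOf_isRamifiedAt hχcont hquad) hfp hN x
  have hcont : Continuous fun a => finiteNorm a + (finiteNorm a)⁻¹ :=
    continuous_finiteNorm.add (continuous_finiteNorm.inv₀ fun a => (finiteNorm_pos a).ne')
  obtain ⟨E, hE⟩ := hK.exists_bound_of_continuousOn hcont.continuousOn
  have hKint : Integrable (K.indicator fun _ => (1 : ℝ)) (Measure.haarMeasure integralIdeles) :=
    (integrable_indicator_iff hK.measurableSet).mpr
      (integrableOn_const hK.measure_lt_top.ne)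
  have hu : Integrable (fun a : Ideles => decay a.1 * K.indicator (fun _ => (1 : ℝ)) a.2)
      ideleMeasure := integrable_decay.mul_prod hKint
  -- `A` bounds the real factor, `B` the finite one, and each `E` bounds the finite idele norm plus
  -- its inverse on the compact support `K`.
  refine ⟨fun ab => A * B * E ^ 2 * ((decay ab.1.1 * K.indicator (fun _ => (1 : ℝ)) ab.1.2) *
    (decay ab.2.1 * K.indicator (fun _ => (1 : ℝ)) ab.2.2)), (hu.mul_prod hu).const_mul _,
    fun s hs1 hs2 ab => ?_⟩
  obtain ⟨hfB, hfK⟩ := hB (ab.1.2, ab.2.2)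
  by_cases hf : finiteOrbit χ p fp N x (ab.1.2, ab.2.2) = 0
  · rw [orbitalIntegrand_eq, hf]
    have h1 (a : Ideles) : 0 ≤ decay a.1 * K.indicator (fun _ => (1 : ℝ)) a.2 :=
      mul_nonneg (decay_nonneg _) (Set.indicator_nonneg (fun _ _ => zero_le_one) _)
    have := mul_nonneg (h1 ab.1) (h1 ab.2)
    simp only [mul_zero, zero_mul, norm_zero]
    positivity
  · obtain ⟨hK1 : ab.1.2 ∈ K, hK2 : ab.2.2 ∈ K⟩ := hfK hf
    have key (a : Ideles) (ha : a.2 ∈ K) {s : ℂ} (hs : |s.re| ≤ 1) :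
        decay a.1 ^ 2 * ‖(ideleNorm a : ℂ) ^ s‖ ≤ decay a.1 * E := by
      have h1 := norm_ideleNorm_cpow_le a hs
      have h2 := (le_abs_self _).trans (hE _ ha)
      have h3 : 0 ≤ |(a.1 : ℝ)| + |(a.1 : ℝ)|⁻¹ := by positivity
      calc decay a.1 ^ 2 * ‖(ideleNorm a : ℂ) ^ s‖
          ≤ decay a.1 ^ 2 * ((|(a.1 : ℝ)| + |(a.1 : ℝ)|⁻¹) * E) :=
            mul_le_mul_of_nonneg_left (h1.trans (mul_le_mul_of_nonneg_left h2 h3)) (sq_nonneg _)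
        _ = decay a.1 * E := by rw [← mul_assoc, decay_sq_mul]
    have hE0 : 0 ≤ E := (norm_nonneg _).trans (hE _ hK1)
    rw [orbitalIntegrand_eq, norm_mul, norm_mul, norm_mul, norm_mul, norm_apply_eq_one hquad]
    simp only [Set.indicator_of_mem hK1, Set.indicator_of_mem hK2]
    set c₁ := ‖(ideleNorm ab.1 : ℂ) ^ s.1‖
    set c₂ := ‖(ideleNorm ab.2 : ℂ) ^ s.2‖
    calc ‖archOrbit k d x (ab.1.1, ab.2.1)‖ * ‖finiteOrbit χ p fp N x (ab.1.2, ab.2.2)‖ * 1 *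
          c₁ * c₂
        ≤ (A * (decay ab.1.1 ^ 2 * decay ab.2.1 ^ 2)) * B * 1 * c₁ * c₂ := by
          gcongr
          exact hA (ab.1.1, ab.2.1)
      _ = A * B * ((decay ab.1.1 ^ 2 * c₁) * (decay ab.2.1 ^ 2 * c₂)) := by ring
      _ ≤ A * B * ((decay ab.1.1 * E) * (decay ab.2.1 * E)) := by
          refine mul_le_mul_of_nonneg_left ?_ (mul_nonneg hA0 hB0)
          exact mul_le_mul (key _ hK1 hs1) (key _ hK2 hs2) (by positivity)
            (mul_nonneg (decay_nonneg _) hE0)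
      _ = _ := by ring

/-- The regular term is the absolutely convergent orbital integral at `s = 0`. -/
theorem isRegularTerm_integral (hk : 2 < k) (hkeven : Even k) (hχcont : Continuous χ)
    (hquad : ∀ a, χ a ^ 2 = 1) (hodd : realChar χ (-1) = -1) (hfp : fp ∈ heckeAlgebra p)
    {N : Nat.Primes} (hN : N ≠ p) (x : RegularParam) :
    IsRegularTerm k d χ p fp N x
      (∫ ab, orbitalIntegrand k d χ p fp N x 0 ab ∂(ideleMeasure.prod ideleMeasure)) := by
  obtain ⟨g, hg, hbound⟩ := exists_integrable_bound (d := d) hk hkeven hχcont hquad hfp hN x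
  have hmeas (s : ℂ × ℂ) := (measurable_orbitalIntegrand (k := k) (d := d) hχcont hquad hodd hfp
    hN x s).aestronglyMeasurable (μ := ideleMeasure.prod ideleMeasure)
  have hnear : ∀ᶠ s in 𝓝[≠] (0 : ℂ × ℂ), |s.1.re| ≤ 1 ∧ |s.2.re| ≤ 1 := by
    refine Filter.Eventually.filter_mono nhdsWithin_le_nhds ?_
    filter_upwards [Metric.closedBall_mem_nhds (0 : ℂ × ℂ) one_pos] with s hs
    have h1 : ‖s‖ ≤ 1 := by simpa using hs
    exact ⟨(Complex.abs_re_le_norm _).trans ((norm_fst_le s).trans h1),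
      (Complex.abs_re_le_norm _).trans ((norm_snd_le s).trans h1)⟩
  -- The limit over `c` is the untruncated integral, since the truncations exhaust the space;
  -- continuity at `s = 0` is dominated convergence.
  refine ⟨fun s => ∫ ab, orbitalIntegrand k d χ p fp N x s ab ∂(ideleMeasure.prod ideleMeasure),
    ?_, ?_⟩
  · filter_upwards [hnear] with s hs
    have hint : Integrable (orbitalIntegrand k d χ p fp N x s) (ideleMeasure.prod ideleMeasure) :=
      hg.mono' (hmeas s) (Eventually.of_forall (hbound s hs.1 hs.2))
    exact ⟨fun c => hint.integrableOn,
      (aecover_truncation _).integral_tendsto_of_countably_generated hint⟩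
  · refine tendsto_integral_filter_of_dominated_convergence g (Eventually.of_forall hmeas) ?_ hg ?_
    · filter_upwards [hnear] with s hs
      exact Eventually.of_forall (hbound s hs.1 hs.2)
    · refine Eventually.of_forall fun ab => ?_
      refine Filter.Tendsto.mono_left ?_ nhdsWithin_le_nhds
      have h1 (a : Ideles) : (ideleNorm a : ℂ) ≠ 0 := by exact_mod_cast (ideleNorm_pos a).ne'
      have hcont : Continuous fun s : ℂ × ℂ => orbitalIntegrand k d χ p fp N x s ab := by
        simp only [orbitalIntegrand_eq]
        exact (continuous_const.mul (continuous_fst.const_cpow (Or.inl (h1 _)))).mul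
          (continuous_snd.const_cpow (Or.inl (h1 _)))
      exact hcont.tendsto 0

/-! ### Factorization at `s = 0` and vanishing of the regular terms -/

theorem measurePreserving_prodProdProdComm {α β : Type*} [MeasurableSpace α] [MeasurableSpace β]
    (μ : Measure α) (ν : Measure β) [SFinite μ] [SFinite ν] :
    MeasurePreserving (fun z : (α × α) × β × β => ((z.1.1, z.2.1), (z.1.2, z.2.2)))
      ((μ.prod μ).prod (ν.prod ν)) ((μ.prod ν).prod (μ.prod ν)) := by
  have h1 := measurePreserving_prodAssoc μ μ (ν.prod ν)
  have h2 := (measurePreserving_prodAssoc μ ν ν).symm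
  have h3 := (Measure.measurePreserving_swap (μ := μ) (ν := ν)).prod (MeasurePreserving.id ν)
  have h4 := measurePreserving_prodAssoc ν μ ν
  have h5 := (MeasurePreserving.id μ).prod (h4.comp (h3.comp h2))
  have h6 := (measurePreserving_prodAssoc μ ν (μ.prod ν)).symm
  exact h6.comp (h5.comp h1)

theorem integral_orbitalIntegrand_zero (hχcont : Continuous χ) (hquad : ∀ a, χ a ^ 2 = 1)
    (hodd : realChar χ (-1) = -1) (hfp : fp ∈ heckeAlgebra p) {N : Nat.Primes} (hN : N ≠ p)
    (x : RegularParam) :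
    ∫ ab, orbitalIntegrand k d χ p fp N x 0 ab ∂(ideleMeasure.prod ideleMeasure) =
      (∫ ab, archOrbit k d x ab * (((ab.1 : ℝ) / |(ab.1 : ℝ)| : ℝ) : ℂ)
        ∂(realUnitsMeasure.prod realUnitsMeasure)) *
      ∫ ab, finiteOrbit χ p fp N x ab * (χ (1, ab.1) : ℂ)
        ∂((Measure.haarMeasure integralIdeles).prod (Measure.haarMeasure integralIdeles)) := by
  have hmp := measurePreserving_prodProdProdComm realUnitsMeasure
    (Measure.haarMeasure integralIdeles)
  rw [ideleMeasure, ← hmp.map_eq, integral_map hmp.measurable.aemeasurable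
    (measurable_orbitalIntegrand hχcont hquad hodd hfp hN x 0).aestronglyMeasurable,
    ← integral_prod_mul]
  refine integral_congr_ae (Eventually.of_forall fun z => ?_)
  simp only [orbitalIntegrand_eq, Prod.fst_zero, Prod.snd_zero, Complex.cpow_zero, mul_one]
  rw [apply_eq_realChar_mul, realChar_eq hquad hodd]
  ring

theorem integral_orbitalIntegrand_eq_zero_of_pos (hkeven : Even k) (hχcont : Continuous χ)
    (hquad : ∀ a, χ a ^ 2 = 1) (hodd : realChar χ (-1) = -1) (hfp : fp ∈ heckeAlgebra p)
    {N : Nat.Primes} (hN : N ≠ p) {x : RegularParam} (hx : 0 < (x : ℚ)) :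
    ∫ ab, orbitalIntegrand k d χ p fp N x 0 ab ∂(ideleMeasure.prod ideleMeasure) = 0 := by
  rw [integral_orbitalIntegrand_zero hχcont hquad hodd hfp hN,
    integral_archOrbit_eq_zero hkeven d hx, zero_mul]

/-- Only finitely many regular terms are nonzero, and none of them if the level is large. -/
theorem exists_bound_of_integral_ne_zero (hkeven : Even k) (hχcont : Continuous χ)
    (hquad : ∀ a, χ a ^ 2 = 1) (hodd : realChar χ (-1) = -1) (hfp : fp ∈ heckeAlgebra p) :
    ∃ D : ℕ, ∃ X : Set RegularParam, X.Finite ∧ ∀ N, N ≠ p → ∀ x : RegularParam,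
      ∫ ab, orbitalIntegrand k d χ p fp N x 0 ab ∂(ideleMeasure.prod ideleMeasure) ≠ 0 →
        x ∈ X ∧ (N : ℕ) ≤ D := by
  obtain ⟨D, X, hX, h⟩ :=
    exists_bound_of_finiteOrbit_ne_zero (finite_setOf_isRamifiedAt hχcont hquad) hfp
  refine ⟨D, X, hX, fun N hN x hne => ?_⟩
  have hx : (x : ℚ) < 0 := by
    by_contra hx
    exact hne (integral_orbitalIntegrand_eq_zero_of_pos hkeven hχcont hquad hodd hfp hN
      (lt_of_le_of_ne (not_lt.mp hx) (Ne.symm x.2.1)))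
  by_contra hcon
  refine hne (integral_eq_zero_of_ae (Eventually.of_forall fun ab => ?_))
  have h0 : finiteOrbit χ p fp N x (ab.1.2, ab.2.2) = 0 := by
    by_contra h1
    exact hcon (h N hN x hx _ h1)
  simp [orbitalIntegrand_eq, h0]

end Global

end RelTrace

end

/-! ### The bound for the regular part -/

theorem proposition3p1
    (k : ℕ) (hk : 2 < k) (hkeven : Even k) (d : ℝ) (hd : 0 < d)
    (χ : RelTrace.Ideles →* ℂˣ) (hχcont : Continuous χ)
    (hχrat : ∀ x : ℚˣ, χ (RelTrace.rationalIdele x) = 1)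
    (hχquad : ∀ a : RelTrace.Ideles, χ a ^ 2 = 1)
    (hχodd : RelTrace.realChar χ (-1) = -1)
    (p : Nat.Primes) (hp : ¬ RelTrace.IsRamifiedAt χ p)
    (fp : GL (Fin 2) ℚ_[p] → ℂ) (hfp : fp ∈ RelTrace.heckeAlgebra p)
    (ε : ℝ) (hε : 0 < ε) :
    ∃ C : ℝ, 0 < C ∧
      ∀ N : Nat.Primes, N ≠ p → ¬ RelTrace.IsRamifiedAt χ N →
        ∃ I : RelTrace.RegularParam → ℂ,
          (∀ x, RelTrace.IsRegularTerm k d χ p fp N x (I x)) ∧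
          Summable I ∧
          ‖∑' x, I x‖ ≤ C / (N : ℝ) ^ ((k : ℝ) / 2 - ε) := by
  obtain ⟨D, X, hX, hne⟩ := RelTrace.exists_bound_of_integral_ne_zero (k := k) (d := d) hkeven
    hχcont hχquad hχodd hfp
  let I : Nat.Primes → RelTrace.RegularParam → ℂ := fun N x =>
    ∫ ab, RelTrace.orbitalIntegrand k d χ p fp N x 0 ab
      ∂(RelTrace.ideleMeasure.prod RelTrace.ideleMeasure)
  have hfin : {N : Nat.Primes | (N : ℕ) ≤ D}.Finite :=
    (Set.finite_Iic D).preimage Subtype.val_injective.injOn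
  -- Only primes `N ≤ D` can give a nonzero sum. Their finitely many values of `‖∑ I‖ · N^(k/2 - ε)`
  -- have a maximum, whatever the exponent.
  obtain ⟨B, hB⟩ := (hfin.image fun N : Nat.Primes =>
    ‖∑' x, I N x‖ * (N : ℝ) ^ ((k : ℝ) / 2 - ε)).bddAbove
  refine ⟨max B 1, by positivity, fun N hN _ => ⟨I N, fun x =>
    RelTrace.isRegularTerm_integral hk hkeven hχcont hχquad hχodd hfp hN x, ?_, ?_⟩⟩
  · exact summable_of_hasFiniteSupport (hX.subset fun x hx => (hne N hN x hx).1)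
  · have hpos : (0 : ℝ) < (N : ℝ) ^ ((k : ℝ) / 2 - ε) :=
      Real.rpow_pos_of_pos (by exact_mod_cast N.2.pos) _
    by_cases hND : (N : ℕ) ≤ D
    · rw [le_div_iff₀ hpos]
      exact (hB ⟨N, hND, rfl⟩).trans (le_max_left _ _)
    · have h0 : ∀ x, I N x = 0 := fun x => by
        by_contra hx
        exact hND (hne N hN x hx).2
      simp only [h0, tsum_zero, norm_zero]
      positivity
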